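/- Let $n\in\mathbb N$, $0<\alpha<1$, let $A$ be a real $n\times n$ matrix, and let $E_\alpha(z)=\sum_{k\ge 0} \frac{z^k}{\Gamma(\alpha k+1)}$ be the Mittag-Leffler function; the series converges for every real number and for every real $n\times n$ matrix $z$. For $t\ge 0$ put $\Phi_t=E_\alpha(At^\alpha):\mathbb R^n\to\mathbb R^n$. A set $S\subseteq\mathbb R^n$ is called invariant if $\Phi_t(S)\subseteq S$ for all $t\ge 0$. The solution curve of $X_0\in\mathbb R^n$ is $C(X_0)=\{\Phi_t X_0: t\ge 0\}$, and $X_0$ is said to lie on an eigenvector of $A$ if $AX_0=\lambda X_0$ for some $\lambda\in\mathbb R$ (so $X_0=0$ is included). 1. For every $X_0\in\mathbb R^n$ the initial value problem ${}_0^C D^\alpha X(t)=AX(t)$ $(t>0)$, $X(0)=X_0$, has exactly one solution $X$ on $[0,\infty)$, namely $X(t)=E_\alpha(At^\alpha)X_0$. Here a solution is a function that is absolutely continuous on every $[0,b]$, takes the value $X_0$ at $0$, and for which, at every $t>0$, the integrand $(t-\tau)^{-\alpha}X'(\tau)$ is integrable on $(0,t)$ and the Caputo derivative ${}_0^C D^\alpha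 X(t)=\frac1{\Gamma(1-\alpha)}\int_0^t (t-\tau)^{-\alpha}X'(\tau)\,d\tau$ equals $AX(t)$. 2. If $X_0$ lies on an eigenvector of $A$, $AX_0=\lambda X_0$, then $\Phi_t X_0=E_\alpha(\lambda t^\alpha)X_0$ for all $t\ge0$, and both the solution curve $C(X_0)$ and the linear span of $X_0$ are invariant. 3. If $X_0$ does not lie on an eigenvector of $A$ and the solution curve $C(X_0)$ is not contained in a straight line, then $C(X_0)$ is not invariant. If $A$ is nonsingular, then $C(X_0)$ is not invariant for every $X_0$ that does not lie on an eigenvector of $A$. -/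

import Mathlib

open MeasureTheory

noncomputable section

namespace FracLin

/-- The Mittag-Leffler function `E_α(z) = ∑ k, z ^ k / Γ(α k + 1)`, for `z` a number or a square
matrix. -/
def mittagLeffler {R : Type*} [Ring R] [Algebra ℝ R] [TopologicalSpace R] (α : ℝ) (z : R) : R :=
  ∑' k : ℕ, (Real.Gamma (α * k + 1))⁻¹ • z ^ k

/-- The integrand `τ ↦ (t - τ) ^ (-α) f'(τ)` of the Caputo derivative of order `0 < α < 1`. -/
def caputoIntegrand {n : ℕ} (α : ℝ) (f : ℝ → Fin n → ℝ) (t τ : ℝ) : Fin n → ℝ :=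
  (t - τ) ^ (-α) • deriv f τ

/-- The Caputo derivative of order `0 < α < 1` with base point `0`:
`(1 / Γ(1 - α)) ∫₀ᵗ (t - τ) ^ (-α) f'(τ) dτ`. -/
def caputoDeriv {n : ℕ} (α : ℝ) (f : ℝ → Fin n → ℝ) (t : ℝ) : Fin n → ℝ :=
  (Real.Gamma (1 - α))⁻¹ • ∫ τ in (0 : ℝ)..t, caputoIntegrand α f t τ

/-- `X` solves the Caputo initial value problem `D^α X = A X`, `X(0) = X₀` on `[0, ∞)`: it is
absolutely continuous on every `[0, b]`, takes the value `X₀` at `0`, and at every `t > 0` the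
Caputo derivative exists and equals `A X(t)`. -/
structure IsSolution {n : ℕ} (α : ℝ) (A : Matrix (Fin n) (Fin n) ℝ) (X₀ : Fin n → ℝ)
    (X : ℝ → Fin n → ℝ) : Prop where
  absolutelyContinuous : ∀ b : ℝ, 0 < b → AbsolutelyContinuousOnInterval X 0 b
  initial : X 0 = X₀
  integrable : ∀ t : ℝ, 0 < t → IntervalIntegrable (caputoIntegrand α X t) volume 0 t
  equation : ∀ t : ℝ, 0 < t → caputoDeriv α X t = A.mulVec (X t)

/-- The map `Φ_t = E_α(A t ^ α)` on `ℝⁿ`. -/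
def flow {n : ℕ} (α : ℝ) (A : Matrix (Fin n) (Fin n) ℝ) (t : ℝ) (x : Fin n → ℝ) : Fin n → ℝ :=
  (mittagLeffler α (t ^ α • A)).mulVec x

/-- The solution curve `{Φ_t(X₀) : t ≥ 0}`. -/
def solutionCurve {n : ℕ} (α : ℝ) (A : Matrix (Fin n) (Fin n) ℝ) (X₀ : Fin n → ℝ) :
    Set (Fin n → ℝ) :=
  (fun t : ℝ => flow α A t X₀) '' Set.Ici 0

/-- `S` is invariant: `Φ_t(S) ⊆ S` for all `t ≥ 0`. -/
def IsInvariant {n : ℕ} (α : ℝ) (A : Matrix (Fin n) (Fin n) ℝ) (S : Set (Fin n → ℝ)) : Prop :=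
  ∀ t : ℝ, 0 ≤ t → flow α A t '' S ⊆ S

/-- `x` lies on an eigenvector of `A`: it is an eigenvector or the equilibrium `0`. -/
def OnEigenvector {n : ℕ} (A : Matrix (Fin n) (Fin n) ℝ) (x : Fin n → ℝ) : Prop :=
  ∃ c : ℝ, A.mulVec x = c • x

end FracLin

end

/-!
Integrating the Caputo equation turns it into the Volterra equation `X = X₀ + J^α (A X)` for the
Riemann–Liouville integral `J^α`. As `J^α` maps `t ^ (a - 1) / Γ(a)` to
`t ^ (a + α - 1) / Γ(a + α)`, the Mittag-Leffler series solves it, and iterating the equation bounds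
the difference of two solutions by the terms of a convergent Mittag-Leffler series.

The Caputo derivative of a function at a first zero that follows positive values is negative, so
the scalar solutions `E_α(c t ^ α)` stay positive. They then sweep out `(0, 1]` or `[1, ∞)`
according to the sign of `c`, and both sets are closed under multiplication, which makes the curve
through an eigenvector invariant.

For the converse put `M(x) = E_α(x A)`. If the curve of `v` were invariant, the two-parameter map
`(x, y) ↦ M(x) M(y) v` would take values in a curve, so its partial derivatives would be everywhere
linearly dependent. At `(0, 0)` both are `M'(0) v`, but to first order in `x` their difference is
`(M'(0)² - M''(0)) v`, a multiple of `A² v` which is nonzero because `2 / Γ(2α + 1) > 1 / Γ(α + 1)²`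
(for `α = 1`, where the flow is a semigroup, this is an equality). Hence `A v` and `A² v` are
linearly dependent; then the curve is straight, and if `A` is nonsingular `v` is an eigenvector.
-/

noncomputable section

namespace FracLin

open MeasureTheory Filter Topology Set

theorem rpow_mul_Gamma_le_Gamma_add {x α : ℝ} (hx : 1 < x) (hα : 0 < α) :
    (x - 1) ^ α * Real.Gamma x ≤ Real.Gamma (x + α) := by
  have hx₁ : 0 < x - 1 := sub_pos.2 hx
  have hx₀ : 0 < x := one_pos.trans hx
  have hΓ₁ := Real.Gamma_pos_of_pos hx₁
  have hΓ := Real.Gamma_pos_of_pos hx₀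
  have hrec : Real.log (Real.Gamma x) - Real.log (Real.Gamma (x - 1)) = Real.log (x - 1) := by
    rw [← Real.log_div hΓ.ne' hΓ₁.ne', ← sub_add_cancel x 1, Real.Gamma_add_one hx₁.ne',
      add_sub_cancel_right, mul_div_cancel_right₀ _ hΓ₁.ne']
  -- Log-convexity: the slope of `log Γ` on `[x, x + α]` is at least its slope on `[x - 1, x]`.
  have hslope := Real.convexOn_log_Gamma.slope_mono_adjacent (mem_Ioi.2 hx₁)
    (mem_Ioi.2 (add_pos hx₀ hα)) (sub_one_lt x) (lt_add_of_pos_right x hα)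
  simp only [Function.comp_apply, hrec, sub_sub_cancel, div_one, add_sub_cancel_left] at hslope
  rw [le_div_iff₀ hα, le_sub_iff_add_le] at hslope
  rw [← Real.log_le_log_iff (by positivity) (Real.Gamma_pos_of_pos (by positivity)),
    Real.log_mul (by positivity) hΓ.ne', Real.log_rpow hx₁, mul_comm]
  exact hslope

theorem tendsto_Gamma_div_Gamma_add {α : ℝ} (hα : 0 < α) :
    Tendsto (fun x : ℝ => Real.Gamma x / Real.Gamma (x + α)) atTop (𝓝 0) := by
  have hlim : Tendsto (fun x : ℝ => (x - 1) ^ (-α)) atTop (𝓝 0) :=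
    (tendsto_rpow_neg_atTop hα).comp (tendsto_atTop_add_const_right _ (-1) tendsto_id)
  refine squeeze_zero' ?_ ?_ hlim <;> filter_upwards [eventually_gt_atTop 1] with x hx
  · have hx₀ : 0 < x := one_pos.trans hx
    exact div_nonneg (Real.Gamma_nonneg_of_nonneg hx₀.le)
      (Real.Gamma_nonneg_of_nonneg (by positivity))
  · have hx₁ : 0 < x - 1 := sub_pos.2 hx
    rw [div_le_iff₀ (Real.Gamma_pos_of_pos (by linarith)), Real.rpow_neg hx₁.le,
      ← div_eq_inv_mul, le_div_iff₀' (by positivity)]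
    exact rpow_mul_Gamma_le_Gamma_add hx hα

/-- The `k`-th Taylor coefficient `1 / Γ(α k + 1)` of the Mittag-Leffler function `E_α`. -/
def mlCoeff (α : ℝ) (k : ℕ) : ℝ := (Real.Gamma (α * k + 1))⁻¹

theorem mlCoeff_pos {α : ℝ} (hα : 0 < α) (k : ℕ) : 0 < mlCoeff α k :=
  inv_pos.2 (Real.Gamma_pos_of_pos (by positivity))

@[simp] theorem mlCoeff_zero (α : ℝ) : mlCoeff α 0 = 1 := by simp [mlCoeff]

theorem tendsto_mlCoeff_succ_div {α : ℝ} (hα : 0 < α) :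
    Tendsto (fun k => mlCoeff α (k + 1) / mlCoeff α k) atTop (𝓝 0) := by
  have hlin : Tendsto (fun k : ℕ => α * (k : ℝ) + 1) atTop atTop :=
    tendsto_atTop_add_const_right _ _ (tendsto_natCast_atTop_atTop.const_mul_atTop hα)
  refine ((tendsto_Gamma_div_Gamma_add hα).comp hlin).congr fun k => ?_
  rw [Function.comp_apply, mlCoeff, mlCoeff, inv_div_inv,
    show α * ((k + 1 : ℕ) : ℝ) + 1 = α * k + 1 + α by push_cast; ring]

theorem summable_mlCoeff_mul_pow {α : ℝ} (hα : 0 < α) (r : ℝ) :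
    Summable fun k => mlCoeff α k * r ^ k := by
  rcases eq_or_ne r 0 with rfl | hr
  · exact summable_of_ne_finset_zero (s := {0}) fun k hk => by
      rw [zero_pow (by simpa using hk), mul_zero]
  refine summable_of_ratio_test_tendsto_lt_one one_pos
    (Eventually.of_forall fun k => mul_ne_zero (mlCoeff_pos hα k).ne' (pow_ne_zero k hr)) ?_
  have hlim := ((tendsto_mlCoeff_succ_div hα).mul_const r).norm
  rw [zero_mul, norm_zero] at hlim
  refine hlim.congr fun k => ?_
  rw [← norm_div, pow_succ, mul_comm (r ^ k), ← mul_assoc,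
    mul_div_mul_right _ _ (pow_ne_zero k hr), mul_div_right_comm]

section PowerSeries

variable {E F : Type*} [NormedAddCommGroup E] [NormedSpace ℝ E] [NormedAddCommGroup F]
  [NormedSpace ℝ F]

/-- The power series in one real variable with coefficients `a k` converges absolutely on all of
`ℝ`. -/
def EntireCoeff (a : ℕ → E) : Prop := ∀ r : ℝ, Summable fun k => ‖r ^ k • a k‖

/-- The sum `∑ x ^ k a k` of a power series in one real variable with vector coefficients. -/
def series (a : ℕ → E) (x : ℝ) : E := ∑' k : ℕ, x ^ k • a k

/-- The coefficients of the termwise derivative of a power series. -/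
def derivCoeff (a : ℕ → E) (k : ℕ) : E := (k + 1 : ℝ) • a (k + 1)

theorem series_zero (a : ℕ → E) : series a 0 = a 0 := by
  rw [series, tsum_eq_single 0 fun k hk => by rw [zero_pow hk, zero_smul], pow_zero, one_smul]

namespace EntireCoeff

variable {a : ℕ → E}

theorem summable [CompleteSpace E] (ha : EntireCoeff a) (x : ℝ) : Summable fun k => x ^ k • a k :=
  (ha x).of_norm

theorem map (ha : EntireCoeff a) (L : E →L[ℝ] F) : EntireCoeff fun k => L (a k) := fun r =>
  ((ha r).mul_left ‖L‖).of_nonneg_of_le (fun _ => norm_nonneg _) fun k => by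
    rw [← L.map_smul]; exact L.le_opNorm _

theorem map_series [CompleteSpace E] (ha : EntireCoeff a) (L : E →L[ℝ] F) (x : ℝ) :
    L (series a x) = series (fun k => L (a k)) x := by
  rw [series, L.map_tsum (ha.summable x)]
  simp only [map_smul, series]

theorem deriv (ha : EntireCoeff a) : EntireCoeff (derivCoeff a) := by
  intro r
  refine ((summable_nat_add_iff 1).2 (ha (2 * (|r| + 1)))).of_nonneg_of_le
    (fun k => norm_nonneg _) fun k => ?_
  have hk : (k + 1 : ℝ) ≤ 2 ^ (k + 1) := by exact_mod_cast (Nat.lt_two_pow_self (n := k + 1)).le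
  have hr : |r| ^ k ≤ (|r| + 1) ^ (k + 1) :=
    (pow_le_pow_left₀ (abs_nonneg r) (by linarith) k).trans
      (pow_le_pow_right₀ (by linarith [abs_nonneg r]) k.le_succ)
  calc ‖r ^ k • derivCoeff a k‖ = (k + 1) * |r| ^ k * ‖a (k + 1)‖ := by
        rw [derivCoeff, norm_smul, norm_smul, norm_pow, Real.norm_eq_abs,
          Real.norm_of_nonneg (show 0 ≤ (k + 1 : ℝ) by positivity)]
        ring
    _ ≤ 2 ^ (k + 1) * (|r| + 1) ^ (k + 1) * ‖a (k + 1)‖ := by gcongr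
    _ = ‖(2 * (|r| + 1)) ^ (k + 1) • a (k + 1)‖ := by
        rw [norm_smul, Real.norm_of_nonneg (by positivity), mul_pow]

theorem summable_norm_deriv (ha : EntireCoeff a) (r : ℝ) :
    Summable fun k : ℕ => ‖(k * r ^ (k - 1)) • a k‖ := by
  rw [← summable_nat_add_iff 1]
  refine (ha.deriv r).congr fun k => ?_
  rw [derivCoeff, smul_smul, add_tsub_cancel_right, Nat.cast_succ, mul_comm]

variable [CompleteSpace E]

theorem tsum_deriv (ha : EntireCoeff a) (x : ℝ) :
    ∑' k : ℕ, (k * x ^ (k - 1)) • a k = series (derivCoeff a) x := by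
  rw [(ha.summable_norm_deriv x).of_norm.tsum_eq_zero_add]
  simp only [Nat.cast_zero, zero_mul, zero_smul, zero_add, add_tsub_cancel_right, series,
    derivCoeff, smul_smul, Nat.cast_succ, mul_comm (x ^ _)]

theorem hasDerivAt (ha : EntireCoeff a) (x : ℝ) :
    HasDerivAt (series a) (series (derivCoeff a) x) x := by
  have hx : x ∈ Metric.ball (0 : ℝ) (|x| + 1) := by simp
  rw [← ha.tsum_deriv x]
  refine hasDerivAt_tsum_of_isPreconnected (ha.summable_norm_deriv (|x| + 1)) Metric.isOpen_ball
    (convex_ball (0 : ℝ) _).isPreconnected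
    (fun k y _ => (hasDerivAt_pow k y).smul_const (a k)) (fun k y hy => ?_) hx (ha.summable x) hx
  rw [norm_smul, norm_smul]
  gcongr ?_ * _
  rw [norm_mul, norm_mul, norm_pow, norm_pow]
  gcongr
  rw [Real.norm_of_nonneg (show 0 ≤ |x| + 1 by positivity)]
  exact (mem_ball_zero_iff.1 hy).le

theorem deriv_series (ha : EntireCoeff a) : _root_.deriv (series a) = series (derivCoeff a) :=
  funext fun x => (ha.hasDerivAt x).deriv

theorem contDiff (ha : EntireCoeff a) (n : ℕ) : ContDiff ℝ n (series a) := by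
  induction n generalizing a with
  | zero =>
    exact contDiff_zero.2 (continuous_iff_continuousAt.2 fun x => (ha.hasDerivAt x).continuousAt)
  | succ n ih =>
    rw [Nat.cast_succ, contDiff_succ_iff_deriv, ha.deriv_series]
    exact ⟨fun x => (ha.hasDerivAt x).differentiableAt, by simp, ih ha.deriv⟩

theorem continuous (ha : EntireCoeff a) : Continuous (series a) :=
  (ha.contDiff 0).continuous

end EntireCoeff

end PowerSeries

section MittagLeffler

variable {𝔸 : Type*} [NormedRing 𝔸] [NormedAlgebra ℝ 𝔸]

theorem summable_norm_mittagLeffler {α : ℝ} (hα : 0 < α) (a : 𝔸) :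
    Summable fun k => ‖mlCoeff α k • a ^ k‖ := by
  refine Summable.of_norm_bounded_eventually_nat (summable_mlCoeff_mul_pow hα ‖a‖) ?_
  filter_upwards [eventually_gt_atTop 0] with k hk
  have := mlCoeff_pos hα k
  rw [norm_norm, norm_smul, Real.norm_of_nonneg this.le]
  gcongr
  exact norm_pow_le' a hk

theorem entireCoeff_mittagLeffler {α : ℝ} (hα : 0 < α) (a : 𝔸) :
    EntireCoeff fun k => mlCoeff α k • a ^ k := fun r => by
  simpa only [smul_pow, smul_comm (r ^ _)] using summable_norm_mittagLeffler hα (r • a)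

theorem mittagLeffler_smul (α : ℝ) (x : ℝ) (a : 𝔸) :
    mittagLeffler α (x • a) = series (fun k => mlCoeff α k • a ^ k) x := by
  simp only [mittagLeffler, series, mlCoeff, smul_pow, smul_comm (x ^ _)]

end MittagLeffler

section Kernel

/-- The Riemann-Liouville kernel `x ↦ x ^ (β - 1) / Γ(β)`, extended by zero to `x ≤ 0` so that
fractional integrals become convolutions. -/
def rlKernel (β x : ℝ) : ℝ := if 0 < x then x ^ (β - 1) / Real.Gamma β else 0

theorem rlKernel_of_pos {β x : ℝ} (hx : 0 < x) : rlKernel β x = x ^ (β - 1) / Real.Gamma β :=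
  if_pos hx

theorem rlKernel_of_nonpos {β x : ℝ} (hx : x ≤ 0) : rlKernel β x = 0 := if_neg hx.not_gt

theorem rlKernel_one_of_pos {x : ℝ} (hx : 0 < x) : rlKernel 1 x = 1 := by
  simp [rlKernel_of_pos hx]

theorem rlKernel_nonneg {β : ℝ} (hβ : 0 < β) (x : ℝ) : 0 ≤ rlKernel β x := by
  have := Real.Gamma_pos_of_pos hβ
  unfold rlKernel
  split_ifs <;> positivity

theorem measurable_rlKernel (β : ℝ) : Measurable (rlKernel β) :=
  Measurable.ite measurableSet_Ioi (by fun_prop) measurable_const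

theorem integral_rpow_mul_rpow_sub {a b x : ℝ} (ha : 0 < a) (hb : 0 < b) (hx : 0 < x) :
    ∫ s in (0 : ℝ)..x, s ^ (b - 1) * (x - s) ^ (a - 1) =
      x ^ (a + b - 1) * (Real.Gamma a * Real.Gamma b / Real.Gamma (a + b)) := by
  have hcast : ∫ s in (0 : ℝ)..x, (s : ℂ) ^ ((b : ℂ) - 1) * ((x : ℂ) - s) ^ ((a : ℂ) - 1) =
      ((∫ s in (0 : ℝ)..x, s ^ (b - 1) * (x - s) ^ (a - 1) : ℝ) : ℂ) := by
    rw [← intervalIntegral.integral_ofReal]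
    refine intervalIntegral.integral_congr fun s hs => ?_
    rw [uIcc_of_le hx.le] at hs
    push_cast [Complex.ofReal_cpow hs.1, Complex.ofReal_cpow (sub_nonneg.2 hs.2)]
    rfl
  have hbeta := Complex.betaIntegral_scaled (b : ℂ) (a : ℂ) hx
  rw [hcast, Complex.betaIntegral_eq_Gamma_mul_div _ _ (by simpa using hb) (by simpa using ha),
    ← Complex.ofReal_add, Complex.Gamma_ofReal, Complex.Gamma_ofReal, Complex.Gamma_ofReal,
    ← Complex.ofReal_one, ← Complex.ofReal_sub, ← Complex.ofReal_cpow hx.le] at hbeta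
  rw [add_comm a b, mul_comm (Real.Gamma a)]
  exact_mod_cast hbeta

theorem rlKernel_mul_rlKernel_eq_zero {a b x s : ℝ} (hs : s ∉ Ioo 0 x) :
    rlKernel a (x - s) * rlKernel b s = 0 := by
  rcases le_or_gt s 0 with h | h
  · rw [rlKernel_of_nonpos h, mul_zero]
  · rw [rlKernel_of_nonpos (sub_nonpos.2 (not_lt.1 fun hsx => hs ⟨h, hsx⟩)), zero_mul]

theorem integral_rlKernel_mul {a b : ℝ} (ha : 0 < a) (hb : 0 < b) (x : ℝ) :
    ∫ s, rlKernel a (x - s) * rlKernel b s = rlKernel (a + b) x := by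
  rw [← setIntegral_eq_integral_of_forall_compl_eq_zero (s := Ioo 0 x) fun s =>
    rlKernel_mul_rlKernel_eq_zero]
  rcases le_or_gt x 0 with hx | hx
  · rw [Ioo_eq_empty hx.not_gt, setIntegral_empty, rlKernel_of_nonpos hx]
  have hΓa := Real.Gamma_pos_of_pos ha
  have hΓb := Real.Gamma_pos_of_pos hb
  have hmul : EqOn (fun s => rlKernel a (x - s) * rlKernel b s)
      (fun s => (Real.Gamma a * Real.Gamma b)⁻¹ * (s ^ (b - 1) * (x - s) ^ (a - 1)))
      (Ioo 0 x) := by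
    intro s hs
    simp only [rlKernel_of_pos hs.1, rlKernel_of_pos (sub_pos.2 hs.2)]
    field_simp
  rw [setIntegral_congr_fun measurableSet_Ioo hmul, integral_const_mul,
    ← integral_Ioc_eq_integral_Ioo, ← intervalIntegral.integral_of_le hx.le,
    integral_rpow_mul_rpow_sub ha hb hx, rlKernel_of_pos hx]
  field_simp

theorem integrable_rlKernel_mul {a b : ℝ} (ha : 0 < a) (hb : 0 < b) (x : ℝ) :
    Integrable fun s => rlKernel a (x - s) * rlKernel b s := by
  rcases le_or_gt x 0 with hx | hx
  · refine (integrable_zero ℝ ℝ volume).congr (Eventually.of_forall fun s => ?_)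
    exact (rlKernel_mul_rlKernel_eq_zero (by simp [Ioo_eq_empty hx.not_gt])).symm
  · refine Integrable.of_integral_ne_zero ?_
    have := Real.Gamma_pos_of_pos (add_pos ha hb)
    rw [integral_rlKernel_mul ha hb, rlKernel_of_pos hx]
    positivity

theorem integral_rlKernel_sub_mul_rlKernel_sub {a b : ℝ} (ha : 0 < a) (hb : 0 < b) (r t : ℝ) :
    ∫ s, rlKernel a (t - s) * rlKernel b (s - r) = rlKernel (a + b) (t - r) := by
  rw [← integral_rlKernel_mul ha hb,
    ← integral_sub_right_eq_self (fun s => rlKernel a (t - r - s) * rlKernel b s) r]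
  simp only [sub_sub_sub_cancel_right]

theorem integrable_rlKernel_sub_mul_rlKernel_sub {a b : ℝ} (ha : 0 < a) (hb : 0 < b) (r t : ℝ) :
    Integrable fun s => rlKernel a (t - s) * rlKernel b (s - r) := by
  simpa only [sub_sub_sub_cancel_right] using
    (integrable_rlKernel_mul ha hb (t - r)).comp_sub_right r

end Kernel

section FractionalIntegral

variable {E : Type*} [NormedAddCommGroup E] [NormedSpace ℝ E]

/-- The Riemann-Liouville fractional integral
`(1 / Γ(β)) ∫₀ᵗ (t - s) ^ (β - 1) f(s) ds` of order `β` with base point `0`. -/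
def rlIntegral (β : ℝ) (f : ℝ → E) (t : ℝ) : E := ∫ s in Ioo 0 t, rlKernel β (t - s) • f s

theorem rlIntegral_congr (β : ℝ) {f g : ℝ → E} {t : ℝ} (h : EqOn f g (Ioo 0 t)) :
    rlIntegral β f t = rlIntegral β g t :=
  setIntegral_congr_fun measurableSet_Ioo fun s hs => by simp only [h hs]

theorem rlIntegral_one (f : ℝ → E) {t : ℝ} (ht : 0 ≤ t) :
    rlIntegral 1 f t = ∫ s in (0 : ℝ)..t, f s := by
  rw [rlIntegral, intervalIntegral.integral_of_le ht, integral_Ioc_eq_integral_Ioo]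
  refine setIntegral_congr_fun measurableSet_Ioo fun s hs => ?_
  simp only [rlKernel_one_of_pos (sub_pos.2 hs.2), one_smul]

theorem rlIntegral_eq_setIntegral_of_le (β : ℝ) (f : ℝ → E) {s t : ℝ} (hst : s ≤ t) :
    rlIntegral β f s = ∫ r in Ioo 0 t, rlKernel β (s - r) • f r := by
  refine (setIntegral_eq_of_subset_of_forall_sdiff_eq_zero measurableSet_Ioo
    (Ioo_subset_Ioo_right hst) fun r hr => ?_).symm
  rw [rlKernel_of_nonpos (sub_nonpos.2 (not_lt.1 fun h => hr.2 ⟨hr.1.1, h⟩)), zero_smul]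

theorem integrable_prod_rlKernel_smul {a b t : ℝ} (ha : 0 < a) (hb : 0 < b) {g : ℝ → E}
    (hg : AEStronglyMeasurable g (volume.restrict (Ioo 0 t)))
    (hint : IntegrableOn (fun r => rlKernel (a + b) (t - r) • g r) (Ioo 0 t)) :
    Integrable (Function.uncurry fun s r => (rlKernel a (t - s) * rlKernel b (s - r)) • g r)
      (volume.prod (volume.restrict (Ioo 0 t))) := by
  have hmeas : AEStronglyMeasurable
      (Function.uncurry fun s r => (rlKernel a (t - s) * rlKernel b (s - r)) • g r)
      (volume.prod (volume.restrict (Ioo (0 : ℝ) t))) := by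
    refine AEStronglyMeasurable.smul (Measurable.aestronglyMeasurable ?_) hg.comp_snd
    exact ((measurable_rlKernel a).comp (measurable_const.sub measurable_fst)).mul
      ((measurable_rlKernel b).comp (measurable_fst.sub measurable_snd))
  refine (integrable_prod_iff' hmeas).2 ⟨Eventually.of_forall fun r =>
    (integrable_rlKernel_sub_mul_rlKernel_sub ha hb r t).smul_const (g r), ?_⟩
  refine hint.norm.congr (Eventually.of_forall fun r => ?_)
  have hnorm : ∀ s, ‖(rlKernel a (t - s) * rlKernel b (s - r)) • g r‖ =
      rlKernel a (t - s) * rlKernel b (s - r) * ‖g r‖ := fun s => by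
    rw [norm_smul, Real.norm_of_nonneg (mul_nonneg (rlKernel_nonneg ha _) (rlKernel_nonneg hb _))]
  simp only [Function.uncurry_apply_pair, hnorm, integral_mul_const,
    integral_rlKernel_sub_mul_rlKernel_sub ha hb, norm_smul,
    Real.norm_of_nonneg (rlKernel_nonneg (add_pos ha hb) _)]

theorem rlIntegral_rlIntegral [CompleteSpace E] {a b t : ℝ} (ha : 0 < a) (hb : 0 < b) {g : ℝ → E}
    (hg : AEStronglyMeasurable g (volume.restrict (Ioo 0 t)))
    (hint : IntegrableOn (fun r => rlKernel (a + b) (t - r) • g r) (Ioo 0 t)) :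
    rlIntegral a (rlIntegral b g) t = rlIntegral (a + b) g t := by
  have houter : rlIntegral a (rlIntegral b g) t =
      ∫ s, ∫ r in Ioo 0 t, (rlKernel a (t - s) * rlKernel b (s - r)) • g r := by
    simp only [mul_smul, integral_smul]
    rw [← setIntegral_eq_integral_of_forall_compl_eq_zero (s := Ioo 0 t)]
    · refine setIntegral_congr_fun measurableSet_Ioo fun s hs => ?_
      simp only [rlIntegral_eq_setIntegral_of_le b g hs.2.le]
    intro s hs
    rcases le_or_gt t s with hts | hst
    · rw [rlKernel_of_nonpos (sub_nonpos.2 hts), zero_smul]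
    · have hs₀ : s ≤ 0 := not_lt.1 fun h => hs ⟨h, hst⟩
      rw [← rlIntegral_eq_setIntegral_of_le b g hst.le, rlIntegral, Ioo_eq_empty hs₀.not_gt,
        setIntegral_empty, smul_zero]
  rw [houter, integral_integral_swap (integrable_prod_rlKernel_smul ha hb hg hint)]
  simp only [integral_smul_const, integral_rlKernel_sub_mul_rlKernel_sub ha hb, rlIntegral]

theorem rlIntegral_tsum_rlKernel [CompleteSpace E] {β : ℝ} (hβ : 0 < β) {b : ℕ → ℝ}
    (hb : ∀ k, 0 < b k) (v : ℕ → E) {t : ℝ}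
    (hv : Summable fun k => ‖rlKernel (b k + β) t • v k‖) :
    rlIntegral β (fun s => ∑' k, rlKernel (b k) s • v k) t =
      ∑' k, rlKernel (b k + β) t • v k := by
  have hbeta : ∀ k, ∫ s in Ioo 0 t, rlKernel β (t - s) * rlKernel (b k) s =
      rlKernel (b k + β) t := fun k => by
    rw [add_comm, ← integral_rlKernel_mul hβ (hb k)]
    exact setIntegral_eq_integral_of_forall_compl_eq_zero fun s => rlKernel_mul_rlKernel_eq_zero
  have hsum := hasSum_integral_of_summable_integral_norm (μ := volume.restrict (Ioo 0 t))
    (F := fun k s => (rlKernel β (t - s) * rlKernel (b k) s) • v k)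
    (fun k => (integrable_rlKernel_mul hβ (hb k) t).integrableOn.smul_const _)
    (hv.congr fun k => by
      rw [norm_smul, Real.norm_of_nonneg (rlKernel_nonneg (add_pos (hb k) hβ) t), ← hbeta,
        ← integral_mul_const]
      refine integral_congr_ae (Eventually.of_forall fun s => ?_)
      simp only [norm_smul, norm_mul, Real.norm_of_nonneg (rlKernel_nonneg hβ _),
        Real.norm_of_nonneg (rlKernel_nonneg (hb k) _)])
  simp only [integral_smul_const, hbeta] at hsum
  rw [hsum.tsum_eq, rlIntegral]
  simp only [mul_smul, tsum_const_smul'']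

theorem integrableOn_rlKernel_smul {a b C t : ℝ} (ha : 0 < a) (hb : 0 < b) {f : ℝ → E}
    (hf : AEStronglyMeasurable f (volume.restrict (Ioo 0 t)))
    (hC : ∀ s ∈ Ioo 0 t, ‖f s‖ ≤ C * rlKernel b s) :
    IntegrableOn (fun s => rlKernel a (t - s) • f s) (Ioo 0 t) := by
  refine Integrable.mono' ((integrable_rlKernel_mul ha hb t).const_mul C).integrableOn
    (((measurable_rlKernel a).comp
      (measurable_const.sub measurable_id)).aestronglyMeasurable.smul hf) ?_
  filter_upwards [ae_restrict_mem measurableSet_Ioo] with s hs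
  rw [norm_smul, Real.norm_of_nonneg (rlKernel_nonneg ha _), mul_left_comm]
  exact mul_le_mul_of_nonneg_left (hC s hs) (rlKernel_nonneg ha _)

theorem integrableOn_rlKernel_smul_of_continuousOn {a t : ℝ} (ha : 0 < a) {f : ℝ → E}
    (hf : ContinuousOn f (Icc 0 t)) :
    IntegrableOn (fun s => rlKernel a (t - s) • f s) (Ioo 0 t) := by
  obtain ⟨C, hC⟩ := isCompact_Icc.exists_bound_of_continuousOn hf
  refine integrableOn_rlKernel_smul (C := C) ha one_pos
    ((hf.mono Ioo_subset_Icc_self).aestronglyMeasurable measurableSet_Ioo) fun s hs => ?_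
  rw [rlKernel_one_of_pos hs.1, mul_one]
  exact hC s (Ioo_subset_Icc_self hs)

theorem norm_rlIntegral_le {a b C t : ℝ} (ha : 0 < a) (hb : 0 < b) {f : ℝ → E}
    (hf : ∀ s ∈ Ioo 0 t, ‖f s‖ ≤ C * rlKernel b s) :
    ‖rlIntegral a f t‖ ≤ C * rlKernel (a + b) t := by
  rw [← integral_rlKernel_mul ha hb, ← integral_const_mul,
    ← setIntegral_eq_integral_of_forall_compl_eq_zero (s := Ioo 0 t) fun s hs => by
      rw [rlKernel_mul_rlKernel_eq_zero hs, mul_zero]]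
  refine norm_integral_le_of_norm_le ((integrable_rlKernel_mul ha hb t).const_mul C).integrableOn ?_
  filter_upwards [ae_restrict_mem measurableSet_Ioo] with s hs
  rw [norm_smul, Real.norm_of_nonneg (rlKernel_nonneg ha _), mul_left_comm]
  exact mul_le_mul_of_nonneg_left (hf s hs) (rlKernel_nonneg ha _)

end FractionalIntegral

section Orbit

variable {E : Type*} [NormedAddCommGroup E] [NormedSpace ℝ E]

/-- The coefficients of the vector power series `x ↦ E_α(x T) v`. -/
def orbitCoeff (α : ℝ) (T : E →L[ℝ] E) (v : E) (k : ℕ) : E := mlCoeff α k • (T ^ k) v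

/-- The curve `t ↦ E_α(t ^ α T) v`, for a bounded operator `T` on a normed space. -/
def mlOrbit (α : ℝ) (T : E →L[ℝ] E) (v : E) (t : ℝ) : E := mittagLeffler α (t ^ α • T) v

theorem entireCoeff_orbitCoeff {α : ℝ} (hα : 0 < α) (T : E →L[ℝ] E) (v : E) :
    EntireCoeff (orbitCoeff α T v) :=
  (entireCoeff_mittagLeffler hα T).map (ContinuousLinearMap.apply ℝ E v)

theorem rlKernel_mul_natCast_add_one (α : ℝ) (k : ℕ) {t : ℝ} (ht : 0 < t) :
    rlKernel (α * k + 1) t = (t ^ α) ^ k * mlCoeff α k := by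
  rw [rlKernel_of_pos ht, add_sub_cancel_right, Real.rpow_mul ht.le, Real.rpow_natCast, mlCoeff,
    div_eq_mul_inv]

theorem rlKernel_mul_natCast_add_self {α : ℝ} (hα : 0 < α) (k : ℕ) {t : ℝ} (ht : 0 < t) :
    rlKernel (α * k + α) t = α * t ^ (α - 1) * ((t ^ α) ^ k * ((k + 1) * mlCoeff α (k + 1))) := by
  have hp : 0 < α * k + α := by positivity
  have hΓ := Real.Gamma_pos_of_pos hp
  have hpow : t ^ (α * k + α - 1) = t ^ (α - 1) * (t ^ α) ^ k := by
    rw [← Real.rpow_natCast, ← Real.rpow_mul ht.le, ← Real.rpow_add ht]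
    ring_nf
  have hcoeff : mlCoeff α (k + 1) = ((α * k + α) * Real.Gamma (α * k + α))⁻¹ := by
    rw [mlCoeff, ← Real.Gamma_add_one hp.ne']
    push_cast
    ring_nf
  rw [rlKernel_of_pos ht, hpow, hcoeff]
  field_simp

theorem summable_norm_rlKernel_smul {α : ℝ} (hα : 0 < α) (T : E →L[ℝ] E) (v : E) {t : ℝ}
    (ht : 0 < t) : Summable fun k : ℕ => ‖rlKernel (α * k + 1) t • (T ^ k) v‖ := by
  simpa only [rlKernel_mul_natCast_add_one α _ ht, orbitCoeff, smul_smul] using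
    entireCoeff_orbitCoeff hα T v (t ^ α)

section Volterra

variable {α b : ℝ} {T : E →L[ℝ] E}

theorem norm_le_of_eq_rlIntegral (hα : 0 < α) {W : ℝ → E} {M : ℝ}
    (hM : ∀ t ∈ Ioc 0 b, ‖W t‖ ≤ M)
    (hW : ∀ t ∈ Ioc 0 b, W t = rlIntegral α (fun s => T (W s)) t) (k : ℕ) :
    ∀ t ∈ Ioc 0 b, ‖W t‖ ≤ ‖T‖ ^ k * M * rlKernel (α * k + 1) t := by
  induction k with
  | zero => simpa +contextual [rlKernel_one_of_pos] using hM
  | succ k ih =>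
    intro t ht
    have hT : ∀ s ∈ Ioo 0 t, ‖T (W s)‖ ≤ ‖T‖ ^ (k + 1) * M * rlKernel (α * k + 1) s := by
      intro s hs
      rw [pow_succ', mul_assoc, mul_assoc, ← mul_assoc (‖T‖ ^ k)]
      exact T.le_opNorm_of_le (ih s ⟨hs.1, hs.2.le.trans ht.2⟩)
    rw [hW t ht, show α * (k + 1 : ℕ) + 1 = α + (α * k + 1) by push_cast; ring]
    exact norm_rlIntegral_le hα (by positivity) hT

theorem eq_zero_of_eq_rlIntegral (hα : 0 < α) {W : ℝ → E} (hcont : ContinuousOn W (Icc 0 b))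
    (hW : ∀ t ∈ Ioc 0 b, W t = rlIntegral α (fun s => T (W s)) t) {t : ℝ} (ht : t ∈ Ioc 0 b) :
    W t = 0 := by
  obtain ⟨M, hM⟩ := isCompact_Icc.exists_bound_of_continuousOn hcont
  have hlim : Tendsto (fun k : ℕ => M * (mlCoeff α k * (‖T‖ * t ^ α) ^ k)) atTop (𝓝 0) := by
    simpa only [mul_zero] using (summable_mlCoeff_mul_pow hα _).tendsto_atTop_zero.const_mul M
  refine norm_le_zero_iff.1 (ge_of_tendsto' hlim fun k => ?_)
  refine (norm_le_of_eq_rlIntegral hα (fun s hs => hM s (Ioc_subset_Icc_self hs)) hW k t ht).trans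
    (le_of_eq ?_)
  rw [rlKernel_mul_natCast_add_one α k ht.1, mul_pow]
  ring

variable [CompleteSpace E]

theorem mittagLeffler_smul_apply (hα : 0 < α) (T : E →L[ℝ] E) (v : E) (x : ℝ) :
    mittagLeffler α (x • T) v = series (orbitCoeff α T v) x := by
  calc mittagLeffler α (x • T) v = series (fun k => mlCoeff α k • T ^ k) x v :=
        congrArg (· v) (mittagLeffler_smul α x T)
    _ = series (orbitCoeff α T v) x :=
        (entireCoeff_mittagLeffler hα T).map_series (ContinuousLinearMap.apply ℝ E v) x

theorem mlOrbit_eq_series (hα : 0 < α) (T : E →L[ℝ] E) (v : E) (t : ℝ) :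
    mlOrbit α T v t = series (orbitCoeff α T v) (t ^ α) :=
  mittagLeffler_smul_apply hα T v (t ^ α)

theorem mlOrbit_zero (hα : 0 < α) (T : E →L[ℝ] E) (v : E) : mlOrbit α T v 0 = v := by
  rw [mlOrbit_eq_series hα, Real.zero_rpow hα.ne', series_zero, orbitCoeff,
    mlCoeff_zero, pow_zero, one_smul, one_apply_eq_self]

theorem continuous_mlOrbit (hα : 0 < α) (T : E →L[ℝ] E) (v : E) : Continuous (mlOrbit α T v) := by
  rw [funext (mlOrbit_eq_series hα T v)]
  exact (entireCoeff_orbitCoeff hα T v).continuous.comp (Real.continuous_rpow_const hα.le)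

theorem hasDerivAt_mlOrbit (hα : 0 < α) (T : E →L[ℝ] E) (v : E) {t : ℝ} (ht : 0 < t) :
    HasDerivAt (mlOrbit α T v)
      ((α * t ^ (α - 1)) • series (derivCoeff (orbitCoeff α T v)) (t ^ α)) t := by
  rw [funext (mlOrbit_eq_series hα T v)]
  exact ((entireCoeff_orbitCoeff hα T v).hasDerivAt (t ^ α)).scomp t
    (Real.hasDerivAt_rpow_const (Or.inl ht.ne'))

theorem mlOrbit_eq_tsum (hα : 0 < α) (T : E →L[ℝ] E) (v : E) {t : ℝ} (ht : 0 < t) :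
    mlOrbit α T v t = ∑' k : ℕ, rlKernel (α * k + 1) t • (T ^ k) v := by
  simp only [mlOrbit_eq_series hα, series, orbitCoeff,
    rlKernel_mul_natCast_add_one α _ ht, smul_smul]

theorem map_mlOrbit_eq_tsum (hα : 0 < α) (T : E →L[ℝ] E) (v : E) {t : ℝ} (ht : 0 < t) :
    T (mlOrbit α T v t) = ∑' k : ℕ, rlKernel (α * k + 1) t • (T ^ (k + 1)) v := by
  rw [mlOrbit_eq_tsum hα T v ht, T.map_tsum (summable_norm_rlKernel_smul hα T v ht).of_norm]
  simp only [map_smul, pow_succ', mul_apply_eq_comp]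

theorem deriv_mlOrbit_eq_tsum (hα : 0 < α) (T : E →L[ℝ] E) (v : E) {t : ℝ} (ht : 0 < t) :
    deriv (mlOrbit α T v) t = ∑' k : ℕ, rlKernel (α * k + α) t • (T ^ (k + 1)) v := by
  rw [(hasDerivAt_mlOrbit hα T v ht).deriv, series, ← tsum_const_smul'']
  refine tsum_congr fun k => ?_
  simp only [rlKernel_mul_natCast_add_self hα k ht, derivCoeff, orbitCoeff, smul_smul, mul_assoc]

theorem rlIntegral_deriv_mlOrbit (hα : 0 < α) (hα₁ : α < 1) (T : E →L[ℝ] E) (v : E) {t : ℝ}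
    (ht : 0 < t) : rlIntegral (1 - α) (deriv (mlOrbit α T v)) t = T (mlOrbit α T v t) := by
  have horder : ∀ k : ℕ, α * k + α + (1 - α) = α * k + 1 := fun k => by ring
  rw [rlIntegral_congr (1 - α) fun s hs => deriv_mlOrbit_eq_tsum hα T v hs.1,
    rlIntegral_tsum_rlKernel (sub_pos.2 hα₁) (fun k => by positivity),
    map_mlOrbit_eq_tsum hα T v ht]
  · simp only [horder]
  · simpa only [horder, pow_succ, mul_apply_eq_comp] using
      summable_norm_rlKernel_smul hα T (T v) ht

theorem mlOrbit_eq_add_rlIntegral (hα : 0 < α) (T : E →L[ℝ] E) (v : E) {t : ℝ} (ht : 0 < t) :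
    mlOrbit α T v t = v + rlIntegral α (fun s => T (mlOrbit α T v s)) t := by
  have horder : ∀ k : ℕ, α * k + 1 + α = α * (k + 1 : ℕ) + 1 := fun k => by push_cast; ring
  have hsum := summable_norm_rlKernel_smul hα T v ht
  rw [rlIntegral_congr α fun s hs => map_mlOrbit_eq_tsum hα T v hs.1,
    rlIntegral_tsum_rlKernel hα (fun k => by positivity), mlOrbit_eq_tsum hα T v ht,
    hsum.of_norm.tsum_eq_zero_add]
  · simp only [horder, Nat.cast_zero, mul_zero, zero_add, rlKernel_one_of_pos ht, one_smul,
      pow_zero, one_apply_eq_self]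
  · simpa only [horder] using (summable_nat_add_iff 1).2 hsum

theorem eq_mlOrbit_of_eq_add_rlIntegral (hα : 0 < α) {v : E} {X : ℝ → E}
    (hcont : ContinuousOn X (Icc 0 b))
    (hX : ∀ t ∈ Ioc 0 b, X t = v + rlIntegral α (fun s => T (X s)) t) {t : ℝ} (ht : t ∈ Ioc 0 b) :
    X t = mlOrbit α T v t := by
  have hY := continuous_mlOrbit hα T v
  refine sub_eq_zero.1 (eq_zero_of_eq_rlIntegral (W := fun t => X t - mlOrbit α T v t) (T := T) hα
    (hcont.sub hY.continuousOn) (fun s hs => ?_) ht)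
  simp only [hX s hs, mlOrbit_eq_add_rlIntegral hα T v hs.1, add_sub_add_left_eq_sub, map_sub,
    rlIntegral, smul_sub]
  rw [integral_sub]
  · exact integrableOn_rlKernel_smul_of_continuousOn hα
      (T.continuous.comp_continuousOn (hcont.mono (Icc_subset_Icc_right hs.2)))
  · exact integrableOn_rlKernel_smul_of_continuousOn hα (T.continuous.comp hY).continuousOn

theorem norm_deriv_mlOrbit_le (hα : 0 < α) (T : E →L[ℝ] E) (v : E) (b : ℝ) :
    ∃ C, ∀ s ∈ Ioo 0 b, ‖deriv (mlOrbit α T v) s‖ ≤ C * rlKernel α s := by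
  have hcont : Continuous fun s : ℝ => series (derivCoeff (orbitCoeff α T v)) (s ^ α) :=
    (entireCoeff_orbitCoeff hα T v).deriv.continuous.comp (Real.continuous_rpow_const hα.le)
  obtain ⟨C, hC⟩ := (isCompact_Icc (a := (0 : ℝ)) (b := b)).exists_bound_of_continuousOn
    hcont.continuousOn
  refine ⟨C * α * Real.Gamma α, fun s hs => ?_⟩
  have hs₀ : 0 < s := hs.1
  have hΓ := Real.Gamma_pos_of_pos hα
  rw [(hasDerivAt_mlOrbit hα T v hs₀).deriv, norm_smul, Real.norm_of_nonneg (by positivity),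
    rlKernel_of_pos hs₀]
  calc α * s ^ (α - 1) * ‖series (derivCoeff (orbitCoeff α T v)) (s ^ α)‖
      ≤ α * s ^ (α - 1) * C := by gcongr; exact hC s (Ioo_subset_Icc_self hs)
    _ = C * α * Real.Gamma α * (s ^ (α - 1) / Real.Gamma α) := by field_simp

theorem integrableOn_rlKernel_smul_deriv_mlOrbit {a : ℝ} (ha : 0 < a) (hα : 0 < α) (T : E →L[ℝ] E)
    (v : E) (t : ℝ) :
    IntegrableOn (fun s => rlKernel a (t - s) • deriv (mlOrbit α T v) s) (Ioo 0 t) := by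
  obtain ⟨C, hC⟩ := norm_deriv_mlOrbit_le hα T v t
  exact integrableOn_rlKernel_smul ha hα (stronglyMeasurable_deriv _).aestronglyMeasurable hC

theorem intervalIntegrable_deriv_mlOrbit (hα : 0 < α) (T : E →L[ℝ] E) (v : E) {t : ℝ}
    (ht : 0 ≤ t) : IntervalIntegrable (deriv (mlOrbit α T v)) volume 0 t := by
  rw [intervalIntegrable_iff_integrableOn_Ioo_of_le ht]
  refine (integrableOn_rlKernel_smul_deriv_mlOrbit one_pos hα T v t).congr_fun (fun s hs => ?_)
    measurableSet_Ioo
  simp only [rlKernel_one_of_pos (sub_pos.2 hs.2), one_smul]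

end Volterra

end Orbit

section AbsolutelyContinuous

theorem absolutelyContinuousOnInterval_of_dist_le {X Y : Type*} [PseudoMetricSpace X]
    [PseudoMetricSpace Y] {f : ℝ → X} {F : ℝ → Y} {a b : ℝ}
    (hF : AbsolutelyContinuousOnInterval F a b)
    (h : ∀ x ∈ uIcc a b, ∀ y ∈ uIcc a b, dist (f x) (f y) ≤ dist (F x) (F y)) :
    AbsolutelyContinuousOnInterval f a b := by
  rw [absolutelyContinuousOnInterval_iff] at hF ⊢
  intro ε hε
  obtain ⟨δ, hδ, hF⟩ := hF ε hε
  refine ⟨δ, hδ, fun D hD hlt => (Finset.sum_le_sum fun i hi => ?_).trans_lt (hF D hD hlt)⟩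
  exact h _ (hD.1 i hi).1 _ (hD.1 i hi).2

theorem absolutelyContinuousOnInterval_congr {X : Type*} [PseudoMetricSpace X] {f g : ℝ → X}
    {a b : ℝ} (hf : AbsolutelyContinuousOnInterval f a b) (h : EqOn g f (uIcc a b)) :
    AbsolutelyContinuousOnInterval g a b :=
  absolutelyContinuousOnInterval_of_dist_le hf fun x hx y hy => by rw [h hx, h hy]

theorem absolutelyContinuousOnInterval_of_hasDerivAt {E : Type*} [NormedAddCommGroup E]
    [NormedSpace ℝ E] [CompleteSpace E] {f f' : ℝ → E} {a b : ℝ} (hab : a ≤ b)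
    (hcont : ContinuousOn f (Icc a b)) (hderiv : ∀ x ∈ Ioo a b, HasDerivAt f (f' x) x)
    (hint : IntervalIntegrable f' volume a b) : AbsolutelyContinuousOnInterval f a b := by
  refine absolutelyContinuousOnInterval_of_dist_le
    (hint.norm.absolutelyContinuousOnInterval_intervalIntegral left_mem_uIcc) fun x hx y hy => ?_
  wlog hxy : x ≤ y generalizing x y
  · rw [dist_comm, dist_comm (∫ r in a..x, ‖f' r‖)]
    exact this y hy x hx (le_of_not_ge hxy)
  have hsub : ∀ u ∈ uIcc a b, ∀ v ∈ uIcc a b, IntervalIntegrable f' volume u v :=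
    fun u hu v hv => hint.mono_set (uIcc_subset_uIcc hu hv)
  have hxy_int := hsub x hx y hy
  have hax_int := hsub a left_mem_uIcc x hx
  have hay_int := hsub a left_mem_uIcc y hy
  rw [uIcc_of_le hab] at hx hy
  have hftc : ∫ r in x..y, f' r = f y - f x :=
    intervalIntegral.integral_eq_sub_of_hasDerivAt_of_le hxy
      (hcont.mono (Icc_subset_Icc hx.1 hy.2))
      (fun r hr => hderiv r ⟨hx.1.trans_lt hr.1, hr.2.trans_le hy.2⟩) hxy_int
  rw [dist_comm, dist_comm (∫ r in a..x, ‖f' r‖), dist_eq_norm, dist_eq_norm, ← hftc,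
    intervalIntegral.integral_interval_sub_left hay_int.norm hax_int.norm]
  exact intervalIntegral.norm_integral_le_abs_integral_norm

variable {ι : Type*} [Fintype ι] {f : ℝ → ι → ℝ} {a b : ℝ}

theorem absolutelyContinuousOnInterval_eval (hf : AbsolutelyContinuousOnInterval f a b) (i : ι) :
    AbsolutelyContinuousOnInterval (fun x => f x i) a b :=
  absolutelyContinuousOnInterval_of_dist_le hf fun x _ y _ => dist_le_pi_dist (f x) (f y) i

theorem ae_deriv_eval (hf : AbsolutelyContinuousOnInterval f a b) :
    ∀ᵐ x, x ∈ uIcc a b → ∀ i, deriv (fun x => f x i) x = deriv f x i := by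
  have hdiff : ∀ᵐ x, ∀ i, x ∈ uIcc a b → DifferentiableAt ℝ (fun x => f x i) x :=
    ae_all_iff.2 fun i => (absolutelyContinuousOnInterval_eval hf i).ae_differentiableAt
  filter_upwards [hdiff] with x hx hxm i
  rw [deriv_pi fun i => hx i hxm]

theorem intervalIntegrable_deriv_pi (hf : AbsolutelyContinuousOnInterval f a b) :
    IntervalIntegrable (deriv f) volume a b := by
  rw [intervalIntegrable_iff]
  refine Integrable.of_eval fun i => ?_
  have hi := (absolutelyContinuousOnInterval_eval hf i).intervalIntegrable_deriv
  rw [intervalIntegrable_iff] at hi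
  refine hi.congr ?_
  filter_upwards [ae_restrict_of_ae (ae_deriv_eval hf), ae_restrict_mem measurableSet_uIoc]
    with x hx hxm
  exact hx (uIoc_subset_uIcc hxm) i

theorem integral_deriv_pi_eq_sub (hab : a ≤ b) (hf : AbsolutelyContinuousOnInterval f a b) :
    ∫ x in a..b, deriv f x = f b - f a := by
  have hint := intervalIntegrable_deriv_pi hf
  ext i
  rw [Pi.sub_apply, ← (absolutelyContinuousOnInterval_eval hf i).integral_deriv_eq_sub,
    intervalIntegral.integral_of_le hab, intervalIntegral.integral_of_le hab, eval_integral]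
  · refine setIntegral_congr_ae measurableSet_Ioc ?_
    filter_upwards [ae_deriv_eval hf] with x hx hxm
    rw [hx (uIcc_of_le hab ▸ Ioc_subset_Icc_self hxm)]
  · exact fun i => ((intervalIntegrable_iff_integrableOn_Ioc_of_le hab).1 hint).eval i

end AbsolutelyContinuous

section Flow

variable {n : ℕ}

/-- The algebra isomorphism taking a matrix `A` to the continuous linear map `x ↦ A x` on `ℝⁿ`;
it carries the flow of `A` to Mittag-Leffler orbits. -/
def matrixCLM : Matrix (Fin n) (Fin n) ℝ ≃ₐ[ℝ] ((Fin n → ℝ) →L[ℝ] (Fin n → ℝ)) :=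
  Matrix.toLinAlgEquiv'.trans (Module.End.toContinuousLinearMap (Fin n → ℝ))

@[simp] theorem matrixCLM_apply (A : Matrix (Fin n) (Fin n) ℝ) (v : Fin n → ℝ) :
    matrixCLM A v = A.mulVec v := rfl

theorem continuous_matrixCLM : Continuous (matrixCLM (n := n)) :=
  (matrixCLM (n := n)).toLinearMap.continuous_of_finiteDimensional

open scoped Matrix.Norms.Operator in
theorem summable_mittagLeffler_matrix {α : ℝ} (hα : 0 < α) (A : Matrix (Fin n) (Fin n) ℝ) :
    Summable fun k : ℕ => (Real.Gamma (α * k + 1))⁻¹ • A ^ k :=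
  (summable_norm_mittagLeffler hα A).of_norm

theorem matrixCLM_mittagLeffler {α : ℝ} (hα : 0 < α) (A : Matrix (Fin n) (Fin n) ℝ) :
    matrixCLM (mittagLeffler α A) = mittagLeffler α (matrixCLM A) := by
  rw [mittagLeffler, (summable_mittagLeffler_matrix hα A).map_tsum matrixCLM continuous_matrixCLM]
  simp only [map_smul, map_pow, mittagLeffler]

theorem flow_eq_mlOrbit {α : ℝ} (hα : 0 < α) (A : Matrix (Fin n) (Fin n) ℝ) (t : ℝ)
    (x : Fin n → ℝ) : flow α A t x = mlOrbit α (matrixCLM A) x t := by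
  rw [flow, mlOrbit, ← map_smul, ← matrixCLM_mittagLeffler hα, matrixCLM_apply]

end Flow

section Solution

variable {n : ℕ} {α : ℝ}

theorem caputoIntegrand_eq_rlKernel (hα₁ : α < 1) (f : ℝ → Fin n → ℝ) {t s : ℝ} (hs : s < t) :
    caputoIntegrand α f t s = Real.Gamma (1 - α) • rlKernel (1 - α) (t - s) • deriv f s := by
  have hΓ := Real.Gamma_pos_of_pos (sub_pos.2 hα₁)
  rw [caputoIntegrand, rlKernel_of_pos (sub_pos.2 hs), smul_smul, mul_div_cancel₀ _ hΓ.ne',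
    sub_sub_cancel_left]

theorem caputoDeriv_eq_rlIntegral (hα₁ : α < 1) (f : ℝ → Fin n → ℝ) {t : ℝ} (ht : 0 ≤ t) :
    caputoDeriv α f t = rlIntegral (1 - α) (deriv f) t := by
  have hΓ := Real.Gamma_pos_of_pos (sub_pos.2 hα₁)
  rw [caputoDeriv, intervalIntegral.integral_of_le ht, integral_Ioc_eq_integral_Ioo,
    setIntegral_congr_fun measurableSet_Ioo fun s hs => caputoIntegrand_eq_rlKernel hα₁ f hs.2,
    integral_smul, inv_smul_smul₀ hΓ.ne', rlIntegral]

variable {A : Matrix (Fin n) (Fin n) ℝ} {X₀ : Fin n → ℝ} {X : ℝ → Fin n → ℝ}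

theorem IsSolution.eq_add_rlIntegral (hX : IsSolution α A X₀ X) (hα : 0 < α) (hα₁ : α < 1) {t : ℝ}
    (ht : 0 < t) : X t = X₀ + rlIntegral α (fun s => matrixCLM A (X s)) t := by
  have hac := hX.absolutelyContinuous t ht
  have hint : IntegrableOn (fun s => rlKernel (α + (1 - α)) (t - s) • deriv X s) (Ioo 0 t) := by
    rw [add_sub_cancel]
    refine ((intervalIntegrable_iff_integrableOn_Ioo_of_le ht.le).1
      (intervalIntegrable_deriv_pi hac)).congr_fun (fun s hs => ?_) measurableSet_Ioo
    simp only [rlKernel_one_of_pos (sub_pos.2 hs.2), one_smul]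
  calc X t = X₀ + rlIntegral 1 (deriv X) t := by
        rw [rlIntegral_one _ ht.le, integral_deriv_pi_eq_sub ht.le hac, hX.initial,
          add_sub_cancel]
    _ = X₀ + rlIntegral α (rlIntegral (1 - α) (deriv X)) t := by
        rw [rlIntegral_rlIntegral hα (sub_pos.2 hα₁) (aestronglyMeasurable_deriv X _) hint,
          add_sub_cancel]
    _ = X₀ + rlIntegral α (fun s => matrixCLM A (X s)) t := by
        rw [rlIntegral_congr α fun s hs => ?_]
        rw [← caputoDeriv_eq_rlIntegral hα₁ X hs.1.le, hX.equation s hs.1, matrixCLM_apply]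

theorem IsSolution.eq_mlOrbit (hX : IsSolution α A X₀ X) (hα : 0 < α) (hα₁ : α < 1) {t : ℝ}
    (ht : 0 ≤ t) : X t = mlOrbit α (matrixCLM A) X₀ t := by
  rcases ht.eq_or_lt with rfl | ht
  · rw [hX.initial, mlOrbit_zero hα]
  have hcont := (hX.absolutelyContinuous t ht).continuousOn
  rw [uIcc_of_le ht.le] at hcont
  exact eq_mlOrbit_of_eq_add_rlIntegral hα hcont
    (fun s hs => hX.eq_add_rlIntegral hα hα₁ hs.1) ⟨ht, le_rfl⟩

theorem isSolution_of_eq_mlOrbit (hα : 0 < α) (hα₁ : α < 1)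
    (hX : ∀ t, 0 ≤ t → X t = mlOrbit α (matrixCLM A) X₀ t) : IsSolution α A X₀ X := by
  have hderiv : ∀ s ∈ Ioi (0 : ℝ), deriv X s = deriv (mlOrbit α (matrixCLM A) X₀) s := fun s hs =>
    EventuallyEq.deriv_eq (by
      filter_upwards [Ioi_mem_nhds hs] with r hr using hX r (le_of_lt hr))
  refine ⟨fun b hb => ?_, ?_, fun t ht => ?_, fun t ht => ?_⟩
  · refine absolutelyContinuousOnInterval_congr
      (absolutelyContinuousOnInterval_of_hasDerivAt hb.le
        (continuous_mlOrbit hα (matrixCLM A) X₀).continuousOn (fun s hs =>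
          (hasDerivAt_mlOrbit hα (matrixCLM A) X₀ hs.1).differentiableAt.hasDerivAt)
        (intervalIntegrable_deriv_mlOrbit hα (matrixCLM A) X₀ hb.le)) fun s hs => ?_
    exact hX s (uIcc_of_le hb.le ▸ hs).1
  · rw [hX 0 le_rfl, mlOrbit_zero hα]
  · rw [intervalIntegrable_iff_integrableOn_Ioo_of_le ht.le]
    have hint := integrableOn_rlKernel_smul_deriv_mlOrbit (sub_pos.2 hα₁) hα (matrixCLM A) X₀ t
    refine IntegrableOn.congr_fun (hint.smul (Real.Gamma (1 - α))) (fun s hs => ?_)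
      measurableSet_Ioo
    rw [caputoIntegrand_eq_rlKernel hα₁ X hs.2, hderiv s hs.1, Pi.smul_apply]
  · rw [caputoDeriv_eq_rlIntegral hα₁ X ht.le, rlIntegral_congr (1 - α) fun s hs => hderiv s hs.1,
      rlIntegral_deriv_mlOrbit hα hα₁ (matrixCLM A) X₀ ht, hX t ht.le, matrixCLM_apply]

end Solution

section ExtremumPrinciple

variable {α t : ℝ} {u : ℝ → ℝ}

theorem hasDerivAt_rlKernel (β : ℝ) {x : ℝ} (hx : 0 < x) :
    HasDerivAt (rlKernel β) ((β - 1) * x ^ (β - 1 - 1) / Real.Gamma β) x :=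
  ((Real.hasDerivAt_rpow_const (Or.inl hx.ne')).div_const _).congr_of_eventuallyEq (by
    filter_upwards [Ioi_mem_nhds hx] with y hy using rlKernel_of_pos hy)

theorem tendsto_rlKernel_sub_mul_sub (hα₁ : α < 1) (hu : DifferentiableAt ℝ u t) :
    Tendsto (fun r => rlKernel (1 - α) (t - r) * (u r - u t)) (𝓝[<] t) (𝓝 0) := by
  have hsub : Tendsto (fun r : ℝ => (t - r) ^ (1 - α)) (𝓝[<] t) (𝓝 0) := by
    have hcont : Continuous fun r : ℝ => (t - r) ^ (1 - α) :=
      (continuous_const.sub continuous_id).rpow_const fun _ => Or.inr (sub_nonneg.2 hα₁.le)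
    simpa [Real.zero_rpow (sub_pos.2 hα₁).ne'] using (hcont.tendsto t).mono_left nhdsWithin_le_nhds
  have hslope : Tendsto (slope u t) (𝓝[<] t) (𝓝 (deriv u t)) :=
    (hasDerivAt_iff_tendsto_slope.1 hu.hasDerivAt).mono_left
      (nhdsWithin_mono t fun r hr => ne_of_lt hr)
  have hlim := ((hsub.mul hslope).div_const (Real.Gamma (1 - α))).neg
  rw [zero_mul, zero_div, neg_zero] at hlim
  refine hlim.congr' ?_
  filter_upwards [self_mem_nhdsWithin] with r hr
  have hr₀ : 0 < t - r := sub_pos.2 hr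
  rw [rlKernel_of_pos hr₀, Real.rpow_sub_one hr₀.ne', slope_def_field, ← neg_sub t r]
  field_simp

theorem integral_rlKernel_mul_deriv_le (hα : 0 < α) (hα₁ : α < 1) {r : ℝ} (hr : r ∈ Ioo 0 t)
    (hcont : ContinuousOn u (Icc 0 t)) (hdiff : ∀ s ∈ Ioc 0 t, DifferentiableAt ℝ u s)
    (hint : IntegrableOn (fun s => rlKernel (1 - α) (t - s) • deriv u s) (Ioo 0 t))
    (hmin : ∀ s ∈ Icc 0 t, u t ≤ u s) :
    ∫ s in (0 : ℝ)..r, rlKernel (1 - α) (t - s) • deriv u s ≤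
      rlKernel (1 - α) (t - r) * (u r - u t) - rlKernel (1 - α) t * (u 0 - u t) := by
  have hΓ := Real.Gamma_pos_of_pos (sub_pos.2 hα₁)
  have hpos : ∀ s ∈ Icc 0 r, 0 < t - s := fun s hs => sub_pos.2 (hs.2.trans_lt hr.2)
  have hker : ∀ s ∈ Icc 0 r, HasDerivAt (fun s => rlKernel (1 - α) (t - s))
      (α * (t - s) ^ (-α - 1) / Real.Gamma (1 - α)) s := fun s hs =>
    ((hasDerivAt_rlKernel (1 - α) (hpos s hs)).comp_const_sub t s).congr_deriv (by
      rw [sub_sub_cancel_left, neg_mul, neg_div, neg_neg])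
  have hle := intervalIntegral.integral_le_sub_of_hasDeriv_right_of_le hr.1.le
    (g := fun s => rlKernel (1 - α) (t - s) * (u s - u t))
    (fun s hs => (hker s hs).continuousAt.continuousWithinAt.mul
      (((hcont s ⟨hs.1, hs.2.trans hr.2.le⟩).mono (Icc_subset_Icc_right hr.2.le)).sub_const _))
    (fun s hs => ((hker s (Ioo_subset_Icc_self hs)).mul
      ((hdiff s ⟨hs.1, (hs.2.trans hr.2).le⟩).hasDerivAt.sub_const (u t))).hasDerivWithinAt)
    (φ := fun s => rlKernel (1 - α) (t - s) • deriv u s)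
    ((integrableOn_Icc_iff_integrableOn_Ioo).2 (hint.mono_set (Ioo_subset_Ioo_right hr.2.le)))
    (fun s hs => le_add_of_nonneg_left (mul_nonneg
      (div_nonneg (mul_nonneg hα.le (Real.rpow_nonneg (hpos s (Ioo_subset_Icc_self hs)).le _))
        hΓ.le)
      (sub_nonneg.2 (hmin s ⟨hs.1.le, (hs.2.trans hr.2).le⟩))))
  simpa only [sub_zero] using hle

theorem rlIntegral_deriv_le_of_isMinOn (hα : 0 < α) (hα₁ : α < 1) (ht : 0 < t)
    (hcont : ContinuousOn u (Icc 0 t)) (hdiff : ∀ s ∈ Ioc 0 t, DifferentiableAt ℝ u s)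
    (hint : IntegrableOn (fun s => rlKernel (1 - α) (t - s) • deriv u s) (Ioo 0 t))
    (hmin : ∀ s ∈ Icc 0 t, u t ≤ u s) :
    rlIntegral (1 - α) (deriv u) t ≤ rlKernel (1 - α) t * (u t - u 0) := by
  have hprim : Tendsto (fun r => ∫ s in (0 : ℝ)..r, rlKernel (1 - α) (t - s) • deriv u s)
      (𝓝[<] t) (𝓝 (rlIntegral (1 - α) (deriv u) t)) := by
    have hlim := (intervalIntegral.continuousOn_primitive_interval'
      ((intervalIntegrable_iff_integrableOn_Ioo_of_le ht.le).2 hint) left_mem_uIcc) t right_mem_uIcc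
    rw [uIcc_of_le ht.le] at hlim
    rw [rlIntegral, ← integral_Ioc_eq_integral_Ioo, ← intervalIntegral.integral_of_le ht.le,
      ← nhdsWithin_Ioo_eq_nhdsLT ht]
    exact hlim.mono_left (nhdsWithin_mono t Ioo_subset_Icc_self)
  have hlim := (tendsto_rlKernel_sub_mul_sub hα₁ (hdiff t ⟨ht, le_rfl⟩)).sub_const
    (rlKernel (1 - α) t * (u 0 - u t))
  rw [zero_sub, ← mul_neg, neg_sub] at hlim
  refine le_of_tendsto_of_tendsto hprim hlim ?_
  filter_upwards [Ioo_mem_nhdsLT ht] with r hr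
  exact integral_rlKernel_mul_deriv_le hα hα₁ hr hcont hdiff hint hmin

theorem pos_of_rlIntegral_deriv_nonneg (hα : 0 < α) (hα₁ : α < 1) (hcont : ContinuousOn u (Ici 0))
    (hdiff : ∀ s, 0 < s → DifferentiableAt ℝ u s)
    (hint : ∀ s, IntegrableOn (fun r => rlKernel (1 - α) (s - r) • deriv u r) (Ioo 0 s))
    (hu₀ : 0 < u 0) (hu : ∀ s, 0 < s → u s = 0 → 0 ≤ rlIntegral (1 - α) (deriv u) s)
    (ht : 0 ≤ t) : 0 < u t := by
  by_contra! hneg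
  have hcont_t : ContinuousOn u (Icc 0 t) := hcont.mono Icc_subset_Ici_self
  obtain ⟨z, ⟨hz, hzero⟩, hleast⟩ : ∃ z, IsLeast (Icc 0 t ∩ u ⁻¹' {0}) z :=
    (isCompact_Icc.of_isClosed_subset (hcont_t.preimage_isClosed_of_isClosed isClosed_Icc
      isClosed_singleton) inter_subset_left).exists_isLeast
      (intermediate_value_Icc' ht hcont_t ⟨hneg, hu₀.le⟩)
  have hz₀ : 0 < z := hz.1.lt_of_ne (by rintro rfl; exact hu₀.ne' hzero)
  have hnonneg : ∀ s ∈ Icc 0 z, u z ≤ u s := by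
    intro s hs
    by_contra! hlt
    rw [hzero] at hlt
    obtain ⟨w, hw, hw₀⟩ := intermediate_value_Icc' hs.1
      (hcont.mono Icc_subset_Ici_self) ⟨hlt.le, hu₀.le⟩
    have hws : w < s := hw.2.lt_of_ne (by rintro rfl; exact hlt.ne hw₀)
    exact (hleast ⟨⟨hw.1, hw.2.trans (hs.2.trans hz.2)⟩, hw₀⟩).not_gt (hws.trans_le hs.2)
  have hle := rlIntegral_deriv_le_of_isMinOn hα hα₁ hz₀ (hcont.mono Icc_subset_Ici_self)
    (fun s hs => hdiff s hs.1) (hint z) hnonneg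
  have hker : 0 < rlKernel (1 - α) z := by
    have := Real.Gamma_pos_of_pos (sub_pos.2 hα₁)
    rw [rlKernel_of_pos hz₀]
    positivity
  rw [mem_preimage, mem_singleton_iff] at hzero
  rw [hzero, zero_sub, mul_neg] at hle
  exact ((hu z hz₀ hzero).trans hle).not_gt (neg_neg_of_pos (mul_pos hker hu₀))

end ExtremumPrinciple

section ScalarOrbit

variable {α : ℝ}

/-- The solution `t ↦ E_α(c t ^ α)` of the scalar equation `D^α u = c u`, `u(0) = 1`. -/
def scalarOrbit (α c t : ℝ) : ℝ := mittagLeffler α (c * t ^ α)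

theorem pow_apply_of_apply_eq_smul {E : Type*} [NormedAddCommGroup E] [NormedSpace ℝ E]
    {T : E →L[ℝ] E} {x : E} {c : ℝ} (hx : T x = c • x) (k : ℕ) : (T ^ k) x = c ^ k • x := by
  induction k with
  | zero => rw [pow_zero, pow_zero, one_smul, one_apply_eq_self]
  | succ k ih => rw [pow_succ', mul_apply_eq_comp, ih, map_smul, hx, smul_smul, pow_succ]

theorem mlOrbit_of_apply_eq_smul {E : Type*} [NormedAddCommGroup E] [NormedSpace ℝ E]
    [CompleteSpace E] (hα : 0 < α) {T : E →L[ℝ] E} {x : E} {c : ℝ} (hx : T x = c • x) (t : ℝ) :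
    mlOrbit α T x t = scalarOrbit α c t • x := by
  rw [mlOrbit_eq_series hα, series, scalarOrbit, mittagLeffler]
  refine (tsum_congr fun k => ?_).trans
    ((summable_norm_mittagLeffler hα (c * t ^ α)).of_norm.tsum_smul_const x)
  rw [orbitCoeff, pow_apply_of_apply_eq_smul hx, smul_smul, smul_smul, mul_pow, smul_eq_mul,
    mlCoeff]
  congr 1
  ring

theorem scalarOrbit_eq_mlOrbit (hα : 0 < α) (c : ℝ) :
    scalarOrbit α c = mlOrbit α (c • (1 : ℝ →L[ℝ] ℝ)) 1 := by
  ext t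
  rw [mlOrbit_of_apply_eq_smul hα (c := c) (by simp), smul_eq_mul, mul_one]

theorem continuous_scalarOrbit (hα : 0 < α) (c : ℝ) : Continuous (scalarOrbit α c) := by
  rw [scalarOrbit_eq_mlOrbit hα]
  exact continuous_mlOrbit hα _ _

theorem scalarOrbit_zero (hα : 0 < α) (c : ℝ) : scalarOrbit α c 0 = 1 := by
  rw [scalarOrbit_eq_mlOrbit hα, mlOrbit_zero hα]

theorem scalarOrbit_eq_one_add (hα : 0 < α) (c : ℝ) {t : ℝ} (ht : 0 < t) :
    scalarOrbit α c t = 1 + c * rlIntegral α (scalarOrbit α c) t := by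
  rw [scalarOrbit_eq_mlOrbit hα, mlOrbit_eq_add_rlIntegral hα _ _ ht, rlIntegral, rlIntegral,
    ← smul_eq_mul c, ← integral_smul]
  simp only [smul_apply, one_apply_eq_self, smul_comm c]

theorem scalarOrbit_pos (hα : 0 < α) (hα₁ : α < 1) (c : ℝ) {t : ℝ} (ht : 0 ≤ t) :
    0 < scalarOrbit α c t := by
  refine pos_of_rlIntegral_deriv_nonneg hα hα₁ (continuous_scalarOrbit hα c).continuousOn
    (fun s hs => ?_) (fun s => ?_) ?_ (fun s hs hzero => ?_) ht
  · rw [scalarOrbit_eq_mlOrbit hα]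
    exact (hasDerivAt_mlOrbit hα _ _ hs).differentiableAt
  · rw [scalarOrbit_eq_mlOrbit hα]
    exact integrableOn_rlKernel_smul_deriv_mlOrbit (sub_pos.2 hα₁) hα _ _ s
  · rw [scalarOrbit_zero hα]
    exact one_pos
  · rw [scalarOrbit_eq_mlOrbit hα] at hzero ⊢
    rw [rlIntegral_deriv_mlOrbit hα hα₁ _ _ hs, hzero, map_zero]

theorem scalarOrbit_le_one (hα : 0 < α) (hα₁ : α < 1) {c : ℝ} (hc : c ≤ 0) {t : ℝ} (ht : 0 ≤ t) :
    scalarOrbit α c t ≤ 1 := by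
  rcases ht.eq_or_lt with rfl | ht
  · rw [scalarOrbit_zero hα]
  · rw [scalarOrbit_eq_one_add hα c ht]
    exact add_le_of_nonpos_right (mul_nonpos_of_nonpos_of_nonneg hc
      (setIntegral_nonneg measurableSet_Ioo fun s hs =>
        mul_nonneg (rlKernel_nonneg hα _) (scalarOrbit_pos hα hα₁ c hs.1.le).le))

theorem one_le_scalarOrbit (hα : 0 < α) (hα₁ : α < 1) {c : ℝ} (hc : 0 ≤ c) {t : ℝ} (ht : 0 ≤ t) :
    1 ≤ scalarOrbit α c t := by
  rcases ht.eq_or_lt with rfl | ht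
  · rw [scalarOrbit_zero hα]
  · rw [scalarOrbit_eq_one_add hα c ht]
    exact le_add_of_nonneg_right (mul_nonneg hc
      (setIntegral_nonneg measurableSet_Ioo fun s hs =>
        mul_nonneg (rlKernel_nonneg hα _) (scalarOrbit_pos hα hα₁ c hs.1.le).le))

theorem const_mul_rlKernel_le_rlIntegral (hα : 0 < α) {u : ℝ → ℝ} {ε t : ℝ}
    (hcont : ContinuousOn u (Icc 0 t)) (hu : ∀ s ∈ Ioo 0 t, ε ≤ u s) :
    ε * rlKernel (α + 1) t ≤ rlIntegral α u t := by
  rw [← integral_rlKernel_mul hα one_pos, ← integral_const_mul,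
    ← setIntegral_eq_integral_of_forall_compl_eq_zero (s := Ioo 0 t) fun s hs => by
      rw [rlKernel_mul_rlKernel_eq_zero hs, mul_zero]]
  refine setIntegral_mono_on ((integrable_rlKernel_mul hα one_pos t).const_mul ε).integrableOn
    (integrableOn_rlKernel_smul_of_continuousOn hα hcont) measurableSet_Ioo fun s hs => ?_
  rw [rlKernel_one_of_pos hs.1, mul_one, mul_comm, smul_eq_mul]
  exact mul_le_mul_of_nonneg_left (hu s hs) (rlKernel_nonneg hα _)

theorem tendsto_rlKernel_add_one_atTop (hα : 0 < α) :
    Tendsto (rlKernel (α + 1)) atTop atTop := by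
  refine ((tendsto_rpow_atTop hα).atTop_div_const
    (Real.Gamma_pos_of_pos (add_pos hα one_pos))).congr' ?_
  filter_upwards [eventually_gt_atTop 0] with t ht
  rw [rlKernel_of_pos ht, add_sub_cancel_right]

theorem tendsto_scalarOrbit_atTop (hα : 0 < α) (hα₁ : α < 1) {c : ℝ} (hc : 0 < c) :
    Tendsto (scalarOrbit α c) atTop atTop := by
  refine tendsto_atTop_mono' _ ?_ ((tendsto_rlKernel_add_one_atTop hα).const_mul_atTop hc)
  filter_upwards [eventually_gt_atTop 0] with t ht
  have hle := const_mul_rlKernel_le_rlIntegral hα (continuous_scalarOrbit hα c).continuousOn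
    fun s (hs : s ∈ Ioo 0 t) => one_le_scalarOrbit hα hα₁ hc.le hs.1.le
  rw [one_mul] at hle
  rw [scalarOrbit_eq_one_add hα c ht]
  exact (mul_le_mul_of_nonneg_left hle hc.le).trans (le_add_of_nonneg_left zero_le_one)

theorem exists_scalarOrbit_lt (hα : 0 < α) (hα₁ : α < 1) {c : ℝ} (hc : c < 0) {ε : ℝ}
    (hε : 0 < ε) : ∃ t, 0 ≤ t ∧ scalarOrbit α c t < ε := by
  by_contra! hge
  obtain ⟨t, hlarge, ht⟩ := (((tendsto_rlKernel_add_one_atTop hα).const_mul_atTop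
    (mul_pos (neg_pos.2 hc) hε)).eventually_gt_atTop 1 |>.and (eventually_gt_atTop 0)).exists
  have hle := const_mul_rlKernel_le_rlIntegral hα (continuous_scalarOrbit hα c).continuousOn
    fun s (hs : s ∈ Ioo 0 t) => hge s hs.1.le
  have hpos := scalarOrbit_pos hα hα₁ c ht.le
  rw [scalarOrbit_eq_one_add hα c ht] at hpos
  linarith [mul_le_mul_of_nonneg_left hle (neg_pos.2 hc).le]

theorem exists_scalarOrbit_eq_of_mem_Ioc (hα : 0 < α) (hα₁ : α < 1) {c : ℝ} (hc : c < 0) {y : ℝ}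
    (hy : y ∈ Ioc 0 1) : ∃ t, 0 ≤ t ∧ scalarOrbit α c t = y := by
  obtain ⟨b, hb, hlt⟩ := exists_scalarOrbit_lt hα hα₁ hc hy.1
  obtain ⟨t, ht, rfl⟩ := intermediate_value_Icc' hb (continuous_scalarOrbit hα c).continuousOn
    ⟨hlt.le, by rw [scalarOrbit_zero hα]; exact hy.2⟩
  exact ⟨t, ht.1, rfl⟩

theorem exists_scalarOrbit_eq_of_one_le (hα : 0 < α) (hα₁ : α < 1) {c : ℝ} (hc : 0 < c) {y : ℝ}
    (hy : 1 ≤ y) : ∃ t, 0 ≤ t ∧ scalarOrbit α c t = y := by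
  obtain ⟨b, hlarge, hb⟩ := (((tendsto_scalarOrbit_atTop hα hα₁ hc).eventually_ge_atTop y).and
    (eventually_ge_atTop 0)).exists
  obtain ⟨t, ht, rfl⟩ := intermediate_value_Icc hb (continuous_scalarOrbit hα c).continuousOn
    ⟨by rwa [scalarOrbit_zero hα], hlarge⟩
  exact ⟨t, ht.1, rfl⟩

theorem exists_scalarOrbit_eq_mul (hα : 0 < α) (hα₁ : α < 1) (c : ℝ) {s t : ℝ} (hs : 0 ≤ s)
    (ht : 0 ≤ t) :
    ∃ r, 0 ≤ r ∧ scalarOrbit α c r = scalarOrbit α c s * scalarOrbit α c t := by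
  have hs₀ := scalarOrbit_pos hα hα₁ c hs
  have ht₀ := scalarOrbit_pos hα hα₁ c ht
  rcases lt_trichotomy c 0 with hc | rfl | hc
  · exact exists_scalarOrbit_eq_of_mem_Ioc hα hα₁ hc ⟨mul_pos hs₀ ht₀, mul_le_one₀
      (scalarOrbit_le_one hα hα₁ hc.le hs) ht₀.le (scalarOrbit_le_one hα hα₁ hc.le ht)⟩
  · have hone : ∀ r, 0 ≤ r → scalarOrbit α 0 r = 1 := fun r hr =>
      (scalarOrbit_le_one hα hα₁ le_rfl hr).antisymm (one_le_scalarOrbit hα hα₁ le_rfl hr)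
    exact ⟨0, le_rfl, by rw [hone 0 le_rfl, hone s hs, hone t ht, one_mul]⟩
  · exact exists_scalarOrbit_eq_of_one_le hα hα₁ hc (one_le_mul_of_one_le_of_one_le
      (one_le_scalarOrbit hα hα₁ hc.le hs) (one_le_scalarOrbit hα hα₁ hc.le ht))

end ScalarOrbit

section Eigenvector

variable {n : ℕ} {α : ℝ} {A : Matrix (Fin n) (Fin n) ℝ} {x : Fin n → ℝ} {c : ℝ}

theorem flow_smul (α : ℝ) (A : Matrix (Fin n) (Fin n) ℝ) (t a : ℝ) (x : Fin n → ℝ) :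
    flow α A t (a • x) = a • flow α A t x :=
  Matrix.mulVec_smul _ _ _

theorem flow_of_mulVec_eq_smul (hα : 0 < α) (hx : A.mulVec x = c • x) (t : ℝ) :
    flow α A t x = scalarOrbit α c t • x := by
  rw [flow_eq_mlOrbit hα, mlOrbit_of_apply_eq_smul hα hx]

theorem isInvariant_solutionCurve_of_mulVec_eq_smul (hα : 0 < α) (hα₁ : α < 1)
    (hx : A.mulVec x = c • x) : IsInvariant α A (solutionCurve α A x) := by
  rintro s hs _ ⟨_, ⟨t, ht, rfl⟩, rfl⟩
  obtain ⟨r, hr, hmul⟩ := exists_scalarOrbit_eq_mul hα hα₁ c ht hs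
  refine ⟨r, hr, ?_⟩
  simp only [flow_of_mulVec_eq_smul hα hx, flow_smul, hmul, smul_smul]

theorem isInvariant_span_of_mulVec_eq_smul (hα : 0 < α) (hx : A.mulVec x = c • x) :
    IsInvariant α A (Submodule.span ℝ {x} : Set (Fin n → ℝ)) := by
  rintro s - _ ⟨y, hy, rfl⟩
  obtain ⟨a, rfl⟩ := Submodule.mem_span_singleton.1 hy
  rw [flow_smul, flow_of_mulVec_eq_smul hα hx]
  exact Submodule.smul_mem _ _ (Submodule.smul_mem _ _ (Submodule.mem_span_singleton_self x))

end Eigenvector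

section GammaInequality

theorem Gamma_add_lt_Gamma_add_one_mul_Gamma {a b : ℝ} (ha : 0 < a) (hb : 0 < b) (hb₁ : b < 1) :
    Real.Gamma (a + b) < Real.Gamma (a + 1) * Real.Gamma b := by
  have hΓ := Real.Gamma_pos_of_pos (add_pos ha hb)
  have hΓa := Real.Gamma_pos_of_pos ha
  have hΓb := Real.Gamma_pos_of_pos hb
  have hbeta := integral_rpow_mul_rpow_sub hb ha one_pos
  rw [Real.one_rpow, one_mul] at hbeta
  have hint : IntervalIntegrable (fun s : ℝ => s ^ (a - 1) * (1 - s) ^ (b - 1)) volume 0 1 :=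
    intervalIntegral.intervalIntegrable_of_integral_ne_zero (by rw [hbeta]; positivity)
  have hint' : IntervalIntegrable (fun s : ℝ => s ^ (a - 1)) volume 0 1 :=
    intervalIntegral.intervalIntegrable_rpow' (by linarith)
  have hpos : 0 < ∫ s in (0 : ℝ)..1, (s ^ (a - 1) * (1 - s) ^ (b - 1) - s ^ (a - 1)) := by
    refine intervalIntegral.intervalIntegral_pos_of_pos_on (hint.sub hint') (fun s hs => ?_) one_pos
    exact sub_pos.2 (lt_mul_of_one_lt_right (Real.rpow_pos_of_pos hs.1 _)
      (Real.one_lt_rpow_of_pos_of_lt_one_of_neg (sub_pos.2 hs.2) (sub_lt_self _ hs.1)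
        (sub_neg.2 hb₁)))
  rw [intervalIntegral.integral_sub hint hint', hbeta, integral_rpow (Or.inl (by linarith)),
    sub_add_cancel, Real.one_rpow, Real.zero_rpow ha.ne', sub_zero, sub_pos,
    div_lt_div_iff₀ ha (by positivity), one_mul] at hpos
  rw [Real.Gamma_add_one ha.ne']
  rw [add_comm b a] at hpos
  linarith

theorem mlCoeff_one_sq_lt {α : ℝ} (hα : 0 < α) (hα₁ : α < 1) :
    mlCoeff α 1 ^ 2 < 2 * mlCoeff α 2 := by
  have hΓ := Real.Gamma_pos_of_pos (show 0 < α + 1 by positivity)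
  have hΓ₂ := Real.Gamma_pos_of_pos (add_pos hα hα)
  have hmul : Real.Gamma (α + 1) = α * Real.Gamma α := Real.Gamma_add_one hα.ne'
  have hlt : α * Real.Gamma (α + α) < Real.Gamma (α + 1) ^ 2 := by
    rw [pow_two]
    nth_rewrite 2 [hmul]
    rw [mul_left_comm]
    gcongr
    exact Gamma_add_lt_Gamma_add_one_mul_Gamma hα hα hα₁
  have hcoeff : 2 * mlCoeff α 2 = (α * Real.Gamma (α + α))⁻¹ := by
    rw [mlCoeff, Nat.cast_ofNat, Real.Gamma_add_one (by positivity), mul_comm α 2, two_mul α]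
    field_simp
    norm_num
  rw [hcoeff, mlCoeff, Nat.cast_one, mul_one, inv_pow]
  exact inv_strictAnti₀ (by positivity) hlt

end GammaInequality

section PlaneImage

variable {F : Type*} [NormedAddCommGroup F] [NormedSpace ℝ F]

theorem exists_notMem_range_of_surjective [FiniteDimensional ℝ F] {V : Type*}
    [NormedAddCommGroup V] [NormedSpace ℝ V] [CompleteSpace V] (hF : 1 < Module.finrank ℝ F)
    {G : V → F} {G' : V →L[ℝ] F} {p : V} (hG : HasStrictFDerivAt G G' p) (hG' : G'.range = ⊤)
    {γ : ℝ → F} (hγ : ContDiff ℝ 1 γ) {U : Set V} (hU : U ∈ 𝓝 p) : ∃ q ∈ U, G q ∉ range γ := by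
  have hGU : G '' U ∈ 𝓝 (G p) := by
    rw [← hG.map_nhds_eq_of_surj hG']
    exact image_mem_map hU
  obtain ⟨_, hγz, q, hq, rfl⟩ :=
    (hγ.dense_compl_range_of_finrank_lt_finrank (by simpa using hF)).inter_nhds_nonempty hGU
  exact ⟨q, hq, hγz⟩

theorem range_eq_top_of_hasDerivAt {G : ℝ × ℝ → F} {G' : ℝ × ℝ →L[ℝ] F} {x y : ℝ} {p q : F}
    (hF : Module.finrank ℝ F = 2) (hG : HasFDerivAt G G' (x, y))
    (hp : HasDerivAt (fun s => G (s, y)) p x) (hq : HasDerivAt (fun s => G (x, s)) q y)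
    (hpq : LinearIndependent ℝ ![p, q]) : G'.range = ⊤ := by
  have hp' : G' (1, 0) = p :=
    (hG.comp_hasDerivAt x ((hasDerivAt_id x).prodMk (hasDerivAt_const x y))).unique hp
  have hq' : G' (0, 1) = q :=
    (hG.comp_hasDerivAt y ((hasDerivAt_const y x).prodMk (hasDerivAt_id y))).unique hq
  rw [eq_top_iff, ← hpq.span_eq_top_of_card_eq_finrank (by simp [hF]), Submodule.span_le]
  rintro _ ⟨i, rfl⟩
  fin_cases i
  exacts [⟨(1, 0), hp'⟩, ⟨(0, 1), hq'⟩]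

theorem eventually_linearIndependent_of_hasDerivAt {a b : ℝ → F} {a' b' : F} {x₀ : ℝ}
    (ha : HasDerivAt a a' x₀) (hb : HasDerivAt b b' x₀) (hab : a x₀ = b x₀)
    (h : LinearIndependent ℝ ![a x₀, b' - a']) :
    ∀ᶠ x in 𝓝[≠] x₀, LinearIndependent ℝ ![a x, b x] := by
  have hlim : Tendsto (fun x => ![a x, slope (b - a) x₀ x]) (𝓝[≠] x₀) (𝓝 ![a x₀, b' - a']) :=
    (ha.continuousAt.tendsto.mono_left nhdsWithin_le_nhds).matrixVecCons
      ((hb.sub ha).tendsto_slope.matrixVecCons tendsto_const_nhds)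
  filter_upwards [hlim.eventually h.eventually, self_mem_nhdsWithin] with x hx hne
  have hunit : IsUnit (x - x₀)⁻¹ := (inv_ne_zero (sub_ne_zero.2 hne)).isUnit
  rw [slope_def_module, Pi.sub_apply, Pi.sub_apply, hab, sub_self, sub_zero, ← one_smul ℝ (a x),
    LinearIndependent.pair_smul_smul_iff isUnit_one hunit, one_smul, sub_eq_neg_add,
    ← neg_one_smul ℝ (a x), LinearIndependent.pair_add_smul_right_iff] at hx
  exact hx

end PlaneImage

section OperatorCurve

variable {E : Type*} [NormedAddCommGroup E] [NormedSpace ℝ E] {M : ℝ → E →L[ℝ] E} {v : E}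

theorem hasDerivAt_map_apply {F : Type*} [NormedAddCommGroup F] [NormedSpace ℝ F] (P : E →L[ℝ] F)
    (w : E) {M' : E →L[ℝ] E} {x : ℝ} (hM : HasDerivAt M M' x) :
    HasDerivAt (fun x => P (M x w)) (P (M' w)) x :=
  P.hasFDerivAt.comp_hasDerivAt x
    ((ContinuousLinearMap.apply ℝ E w).hasFDerivAt.comp_hasDerivAt x hM)

theorem exists_linearIndependent_apply_deriv {F : Type*} [NormedAddCommGroup F] [NormedSpace ℝ F]
    (P : E →L[ℝ] F) (hM : ContDiff ℝ 2 M) (hM₀ : M 0 = 1)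
    (h : LinearIndependent ℝ ![P (deriv M 0 v), P ((deriv M 0 ^ 2 - deriv (deriv M) 0) v)]) :
    ∃ x y, 0 < x ∧ 0 < y ∧
      LinearIndependent ℝ ![P (deriv M x (M y v)), P (M x (deriv M y v))] := by
  have hM' : ContDiff ℝ 1 (deriv M) := ((contDiff_succ_iff_deriv (n := 1)).1 hM).2.2
  have hd : HasDerivAt M (deriv M 0) 0 := (hM.differentiable two_ne_zero 0).hasDerivAt
  have hd' : HasDerivAt (deriv M) (deriv (deriv M) 0) 0 :=
    (hM'.differentiable one_ne_zero 0).hasDerivAt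
  have hsmall : ∀ᶠ x in 𝓝[≠] (0 : ℝ),
      LinearIndependent ℝ ![P (deriv M x v), P (M x (deriv M 0 v))] := by
    refine eventually_linearIndependent_of_hasDerivAt (hasDerivAt_map_apply P v hd')
      (hasDerivAt_map_apply P (deriv M 0 v) hd) (by rw [hM₀, one_apply_eq_self]) ?_
    rwa [← map_sub, ← mul_apply_eq_comp, ← pow_two, ← sub_apply]
  obtain ⟨x, hx, hx₀⟩ :=
    ((hsmall.filter_mono (nhdsGT_le_nhdsNE 0)).and self_mem_nhdsWithin).exists
  have hcont : Continuous fun y => ![P (deriv M x (M y v)), P (M x (deriv M y v))] := by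
    have := hM.continuous
    have := hM'.continuous
    fun_prop
  have hnear : ∀ᶠ y in 𝓝 (0 : ℝ),
      LinearIndependent ℝ ![P (deriv M x (M y v)), P (M x (deriv M y v))] := by
    refine hcont.continuousAt.eventually (LinearIndependent.eventually ?_)
    simpa only [hM₀, one_apply_eq_self] using hx
  obtain ⟨y, hy, hy₀⟩ :=
    ((hnear.filter_mono nhdsWithin_le_nhds).and self_mem_nhdsWithin).exists (f := 𝓝[>] 0)
  exact ⟨x, y, hx₀, hy₀, hy⟩

theorem exists_linearIndependent_comp {ι : Type*} [Finite ι] {w : ι → E}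
    (h : LinearIndependent ℝ w) :
    ∃ P : E →L[ℝ] Submodule.span ℝ (range w), LinearIndependent ℝ (P ∘ w) := by
  have := FiniteDimensional.span_of_finite ℝ (finite_range w)
  obtain ⟨P, hP⟩ := Submodule.ClosedComplemented.of_finiteDimensional (Submodule.span ℝ (range w))
  refine ⟨P, LinearIndependent.of_comp (Submodule.subtype _) ?_⟩
  convert h
  ext i
  exact congrArg Subtype.val (hP ⟨w i, Submodule.subset_span (mem_range_self i)⟩)

theorem exists_forall_apply_apply_ne (hM : ContDiff ℝ 2 M) (hM₀ : M 0 = 1)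
    (h : LinearIndependent ℝ ![deriv M 0 v, (deriv M 0 ^ 2 - deriv (deriv M) 0) v]) :
    ∃ x y, 0 < x ∧ 0 < y ∧ ∀ z, M x (M y v) ≠ M z v := by
  have hfinrank := (finrank_span_eq_card h).trans (Fintype.card_fin 2)
  obtain ⟨P, hP⟩ := exists_linearIndependent_comp h
  rw [← FinVec.map_eq] at hP
  have := FiniteDimensional.of_finrank_pos (hfinrank ▸ two_pos)
  obtain ⟨x, y, hx, hy, hxy⟩ := exists_linearIndependent_apply_deriv P hM hM₀ hP
  have hM₁ : ContDiff ℝ 1 M := hM.of_le one_le_two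
  have hd : ∀ z, HasDerivAt M (deriv M z) z := fun z =>
    (hM₁.differentiable one_ne_zero z).hasDerivAt
  have hG : ContDiff ℝ 1 fun q : ℝ × ℝ => P (M q.1 (M q.2 v)) := by fun_prop
  have hstrict := hG.contDiffAt.hasStrictFDerivAt (x := (x, y)) one_ne_zero
  obtain ⟨q, hq, hne⟩ := exists_notMem_range_of_surjective (one_lt_two.trans_eq hfinrank.symm)
    hstrict (range_eq_top_of_hasDerivAt hfinrank hstrict.hasFDerivAt
      (hasDerivAt_map_apply P (M y v) (hd x)) (hasDerivAt_map_apply (P ∘L M x) v (hd y)) hxy)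
    (γ := fun z => P (M z v)) (by fun_prop) (prod_mem_nhds (Ioi_mem_nhds hx) (Ioi_mem_nhds hy))
  exact ⟨q.1, q.2, hq.1, hq.2, fun z hz => hne ⟨z, congrArg P hz.symm⟩⟩

end OperatorCurve

section NotInvariant

theorem exists_forall_mittagLeffler_smul_ne {E : Type*} [NormedAddCommGroup E] [NormedSpace ℝ E]
    [CompleteSpace E] {α : ℝ} (hα : 0 < α) (hα₁ : α < 1) {T : E →L[ℝ] E} {v : E}
    (h : LinearIndependent ℝ ![T v, T (T v)]) :
    ∃ x y : ℝ, 0 < x ∧ 0 < y ∧ ∀ z : ℝ,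
      mittagLeffler α (x • T) (mittagLeffler α (y • T) v) ≠ mittagLeffler α (z • T) v := by
  have hM := entireCoeff_mittagLeffler hα T
  have hseries : (fun x : ℝ => mittagLeffler α (x • T)) = series fun k => mlCoeff α k • T ^ k :=
    funext fun x => mittagLeffler_smul α x T
  have hzero : series (fun k => mlCoeff α k • T ^ k) 0 = 1 := by
    rw [series_zero, mlCoeff_zero, one_smul, pow_zero]
  have hderiv : deriv (series fun k => mlCoeff α k • T ^ k) 0 = mlCoeff α 1 • T := by
    simp [hM.deriv_series, series_zero, derivCoeff]
  have hderiv₂ : deriv (deriv (series fun k => mlCoeff α k • T ^ k)) 0 =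
      (2 * mlCoeff α 2) • T ^ 2 := by
    rw [hM.deriv_series, hM.deriv.deriv_series, series_zero]
    norm_num [derivCoeff, smul_smul]
  have hne : mlCoeff α 1 ^ 2 - 2 * mlCoeff α 2 ≠ 0 := (sub_neg.2 (mlCoeff_one_sq_lt hα hα₁)).ne
  have := exists_forall_apply_apply_ne (v := v) (hM.contDiff 2) hzero (by
    rw [hderiv, hderiv₂, smul_pow, ← sub_smul, smul_apply, smul_apply,
      LinearIndependent.pair_smul_smul_iff (mlCoeff_pos hα 1).ne'.isUnit hne.isUnit]
    exact h)
  rwa [← hseries] at this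

variable {n : ℕ} {α : ℝ} {A : Matrix (Fin n) (Fin n) ℝ} {x : Fin n → ℝ}

theorem not_isInvariant_solutionCurve (hα : 0 < α) (hα₁ : α < 1)
    (h : LinearIndependent ℝ ![A.mulVec x, A.mulVec (A.mulVec x)]) :
    ¬ IsInvariant α A (solutionCurve α A x) := by
  intro hinv
  obtain ⟨a, b, ha, hb, hab⟩ :=
    exists_forall_mittagLeffler_smul_ne (T := matrixCLM A) hα hα₁ h
  have hpow : ∀ c : ℝ, 0 < c → (c ^ α⁻¹) ^ α = c := fun c hc => Real.rpow_inv_rpow hc.le hα.ne'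
  obtain ⟨z, -, hz⟩ := hinv (a ^ α⁻¹) (Real.rpow_nonneg ha.le _)
    ⟨_, ⟨b ^ α⁻¹, Real.rpow_nonneg hb.le _, rfl⟩, rfl⟩
  simp only [flow_eq_mlOrbit hα, mlOrbit, hpow a ha, hpow b hb] at hz
  exact hab (z ^ α) hz.symm

theorem linearIndependent_or_mulVec_mulVec_eq_smul (hx : ¬ OnEigenvector A x) :
    LinearIndependent ℝ ![A.mulVec x, A.mulVec (A.mulVec x)] ∨
      ∃ c : ℝ, A.mulVec (A.mulVec x) = c • A.mulVec x := by
  have hAx : A.mulVec x ≠ 0 := fun h => hx ⟨0, by rw [h, zero_smul]⟩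
  rw [LinearIndependent.pair_iff' hAx, or_iff_not_imp_left, not_forall_not]
  exact fun ⟨c, hc⟩ => ⟨c, hc.symm⟩

theorem collinear_solutionCurve {c : ℝ} (hα : 0 < α)
    (h : A.mulVec (A.mulVec x) = c • A.mulVec x) : Collinear ℝ (solutionCurve α A x) := by
  rw [collinear_iff_exists_forall_eq_smul_vadd]
  refine ⟨x, A.mulVec x, ?_⟩
  rintro _ ⟨t, ht, rfl⟩
  simp only [flow_eq_mlOrbit hα]
  rcases (mem_Ici.1 ht).eq_or_lt with rfl | ht
  · exact ⟨0, by rw [mlOrbit_zero hα, zero_smul, zero_vadd]⟩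
  refine ⟨rlIntegral α (scalarOrbit α c) t, ?_⟩
  have hA : ∀ s ∈ Ioo 0 t, matrixCLM A (mlOrbit α (matrixCLM A) x s) =
      scalarOrbit α c s • A.mulVec x := by
    intro s hs
    rw [← flow_of_mulVec_eq_smul hα h, flow_eq_mlOrbit hα, map_mlOrbit_eq_tsum hα _ _ hs.1,
      mlOrbit_eq_tsum hα _ _ hs.1]
    simp only [pow_succ, mul_apply_eq_comp, matrixCLM_apply]
  rw [mlOrbit_eq_add_rlIntegral hα _ _ ht, rlIntegral_congr α hA, vadd_eq_add, add_comm]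
  simp only [rlIntegral, ← smul_assoc]
  rw [integral_smul_const]

theorem onEigenvector_of_det_ne_zero {c : ℝ} (hdet : A.det ≠ 0)
    (h : A.mulVec (A.mulVec x) = c • A.mulVec x) : OnEigenvector A x := by
  refine ⟨c, sub_eq_zero.1 (Matrix.eq_zero_of_mulVec_eq_zero hdet ?_)⟩
  rw [Matrix.mulVec_sub, Matrix.mulVec_smul, h, sub_self]

end NotInvariant

end FracLin

end

theorem mainTheorem3 (n : ℕ) (α : ℝ) (hα₀ : 0 < α) (hα₁ : α < 1)
    (A : Matrix (Fin n) (Fin n) ℝ) :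
    -- the Mittag-Leffler series converge
    (∀ c : ℝ, Summable fun k : ℕ => (Real.Gamma (α * k + 1))⁻¹ • c ^ k) ∧
    (∀ M : Matrix (Fin n) (Fin n) ℝ,
      Summable fun k : ℕ => (Real.Gamma (α * k + 1))⁻¹ • M ^ k) ∧
    -- the unique solution of the initial value problem is `E_α(A t ^ α) X₀`
    (∀ (X₀ : Fin n → ℝ) (X : ℝ → Fin n → ℝ),
      FracLin.IsSolution α A X₀ X ↔
        ∀ t : ℝ, 0 ≤ t → X t = (FracLin.mittagLeffler α (t ^ α • A)).mulVec X₀) ∧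
    -- initial point on an eigenvector: the curve stays on its line; curve and line are invariant
    (∀ (X₀ : Fin n → ℝ) (c : ℝ), A.mulVec X₀ = c • X₀ →
      (∀ t : ℝ, 0 ≤ t → FracLin.flow α A t X₀ = FracLin.mittagLeffler α (c * t ^ α) • X₀) ∧
      FracLin.IsInvariant α A (FracLin.solutionCurve α A X₀) ∧
      FracLin.IsInvariant α A (Submodule.span ℝ {X₀} : Set (Fin n → ℝ))) ∧
    -- initial point not on an eigenvector: a curve that is not straight is not invariant
    (∀ X₀ : Fin n → ℝ, ¬ FracLin.OnEigenvector A X₀ →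
      ¬ Collinear ℝ (FracLin.solutionCurve α A X₀) →
      ¬ FracLin.IsInvariant α A (FracLin.solutionCurve α A X₀)) ∧
    -- for nonsingular `A` no exception is needed
    (A.det ≠ 0 → ∀ X₀ : Fin n → ℝ, ¬ FracLin.OnEigenvector A X₀ →
      ¬ FracLin.IsInvariant α A (FracLin.solutionCurve α A X₀)) := by
  refine ⟨fun c => (FracLin.summable_norm_mittagLeffler hα₀ c).of_norm,
    FracLin.summable_mittagLeffler_matrix hα₀, fun X₀ X => ⟨fun hX t ht => ?_, fun hX => ?_⟩,
    fun X₀ c h => ⟨fun t _ => FracLin.flow_of_mulVec_eq_smul hα₀ h t,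
      FracLin.isInvariant_solutionCurve_of_mulVec_eq_smul hα₀ hα₁ h,
      FracLin.isInvariant_span_of_mulVec_eq_smul hα₀ h⟩,
    fun X₀ hX₀ hcurve => ?_, fun hdet X₀ hX₀ => ?_⟩
  · exact (hX.eq_mlOrbit hα₀ hα₁ ht).trans (FracLin.flow_eq_mlOrbit hα₀ A t X₀).symm
  · exact FracLin.isSolution_of_eq_mlOrbit hα₀ hα₁ fun t ht =>
      (hX t ht).trans (FracLin.flow_eq_mlOrbit hα₀ A t X₀)
  · rcases FracLin.linearIndependent_or_mulVec_mulVec_eq_smul hX₀ with hindep | ⟨c, hc⟩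
    · exact FracLin.not_isInvariant_solutionCurve hα₀ hα₁ hindep
    · exact absurd (FracLin.collinear_solutionCurve hα₀ hc) hcurve
  · rcases FracLin.linearIndependent_or_mulVec_mulVec_eq_smul hX₀ with hindep | ⟨c, hc⟩
    · exact FracLin.not_isInvariant_solutionCurve hα₀ hα₁ hindep
    · exact absurd (FracLin.onEigenvector_of_det_ne_zero hdet hc) hX₀
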